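/- Let $G$ be a finite-dimensional connected real Lie group whose Lie algebra $\mathfrak g$ carries a non-degenerate invariant symmetric bilinear form $\langle\cdot,\cdot\rangle$. Let $R\in\mathrm{End}\,\mathfrak g$ be a split $R$-matrix, i.e. $R$ is skew-symmetric for $\langle\cdot,\cdot\rangle$ and $$[RX,RY]-R\big([RX,Y]+[X,RY]\big)=-[X,Y]\qquad (X,Y\in\mathfrak g).$$ Put $R^\pm=R\pm 1$, and let $G_R\subset G\times G$ be the connected Lie subgroup with Lie algebra $\{(R^+X,R^-X): X\in\mathfrak g\}$. For $A\in\mathrm{End}\,\mathfrak g$ let $A_{12}\in\mathfrak g\otimes\mathfrak g$ be its kernel, $(AX)_1=\langle A_{12},X_2\rangle_2$, and let $C_{12}$ be the kernel of the identity. Let $\upsilon_\pm\in\mathbb R\setminus\{0\}$. Consider smooth fields $(\Psi^+,\Psi^-)$ with values in $G\times G$, functions of the lifted coordinate $\theta\in\mathbb R$ of the circle, which factorise as $$\Psi^\pm(\theta)=g(\theta)\,x_\pm(\theta),\qquad g(\theta)\in G,\quad (x_+(\theta),x_-(\theta))\in G_R,$$ with $g$ and $(x_+,x_-)$ smooth as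 maps into $G$ and into the Lie group $G_R$. Let functionals of $\Psi^\pm$ be equipped with the bracket determined by the exchange algebra $$\{\Psi^\pm_1(\theta),\Psi^\pm_2(\theta')\}=\pm\upsilon_\pm\,\Psi^\pm_1(\theta)\Psi^\pm_2(\theta')\big(R^+_{12}H_{\theta\theta'}+R^-_{12}H_{\theta'\theta}\big),\qquad \{\Psi^+_1(\theta),\Psi^-_2(\theta')\}=0,$$ where $H_{\theta\theta'}=n$ for $2\pi n<\theta-\theta'<2\pi(n+1)$. All brackets below are identities of distributions for $\theta,\theta'$ in a common open interval $(a,a+2\pi)$, $a\in\mathbb R$ arbitrary, and $\delta'_{\theta\theta'}=\partial_\theta\delta_{\theta\theta'}$. Define $$\mathcal J=\tfrac12\big(\upsilon_+^{-1}\,\partial_\theta x_+\,x_+^{-1}-\upsilon_-^{-1}\,\partial_\theta x_-\,x_-^{-1}\big).$$ This is a smooth $\mathfrak g$-valued field, and it is $2\pi$-periodic whenever $g$ and $\partial_\theta\Psi^\pm(\Psi^\pm)^{-1}$ are. Moreover: 1. If $\upsilon_+=\upsilon_-$ or $R^2=\mathrm{id}$, then $$\{g_1(\theta),g_2(\theta')\}=0,\qquad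 \{\mathcal J_1(\theta),g_2(\theta')\}=g_2(\theta)\,C_{12}\,\delta_{\theta\theta'},$$ $$\{\mathcal J_1(\theta),\mathcal J_2(\theta')\}=-[C_{12},\mathcal J_2(\theta)]\,\delta_{\theta\theta'}-\tfrac12\big(\upsilon_-^{-1}-\upsilon_+^{-1}\big)\,C_{12}\,\delta'_{\theta\theta'}.$$ 2. If $\upsilon_+=\upsilon_-=\upsilon$, then $\partial_\theta x_\pm\,x_\pm^{-1}=\upsilon R^\pm\mathcal J$, and the brackets in 1 are the canonical Poisson brackets of $T^*\mathcal LG$ (no $\delta'$ term). 3. If $\upsilon_+\neq\upsilon_-$, the condition $R^2=\mathrm{id}$ is necessary: if $R^2\neq\mathrm{id}$, then at every such field $(\Psi^+,\Psi^-)$ and for every $a$ the distribution $\{g_1(\theta),g_2(\theta')\}$ on $(a,a+2\pi)^2$ is not zero. -/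

import Mathlib

open scoped Manifold ContDiff

noncomputable section

namespace RealBranch

/-! Throughout, `G` is a finite-dimensional real Lie group modelled on the vector space `E`. By
definition of the tangent space, the Lie algebra `T_1 G` of `G` has `E` as underlying vector space,
so that `𝔤`-valued objects are written as `E`-valued ones; the Lie bracket on `E` is `lieBr G`. -/

section LieAlgebra

variable {E : Type*} [NormedAddCommGroup E] [NormedSpace ℝ E]
  (G : Type*) [TopologicalSpace G] [ChartedSpace E G] [Group G]

/-- The Lie bracket of `𝔤 = T_1 G` (bracket of left-invariant vector fields). -/
def lieBr (X Y : E) : E :=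
  Bracket.bracket (L := GroupLieAlgebra 𝓘(ℝ, E) G) (M := GroupLieAlgebra 𝓘(ℝ, E) G) X Y

/-- A non-degenerate invariant symmetric bilinear form on `𝔤`. -/
structure IsInvariantForm (B : LinearMap.BilinForm ℝ E) : Prop where
  symm : ∀ X Y, B X Y = B Y X
  nondegenerate : B.Nondegenerate
  invariant : ∀ X Y Z, B (lieBr G X Y) Z = B X (lieBr G Y Z)

/-- A split `R`-matrix: a skew-symmetric solution of the modified classical Yang-Baxter equation
`[RX, RY] - R([RX, Y] + [X, RY]) = - c² [X, Y]` with `c = 1`. -/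
structure IsSplitRMatrix (B : LinearMap.BilinForm ℝ E) (R : E →ₗ[ℝ] E) : Prop where
  skew : ∀ X Y, B (R X) Y = - B X (R Y)
  mcybe : ∀ X Y, lieBr G (R X) (R Y) - R (lieBr G (R X) Y + lieBr G X (R Y)) = - lieBr G X Y

end LieAlgebra

section Maps

variable {E : Type*} [NormedAddCommGroup E] [NormedSpace ℝ E]
  {G : Type*} [TopologicalSpace G] [ChartedSpace E G] [Group G]
  {V : Type*} [NormedAddCommGroup V] [NormedSpace ℝ V]

/-- `R⁺ = R + 1`. -/
def Rplus (R : E →ₗ[ℝ] E) : E →ₗ[ℝ] E := R + LinearMap.id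

/-- `R⁻ = R - 1`. -/
def Rminus (R : E →ₗ[ℝ] E) : E →ₗ[ℝ] E := R - LinearMap.id

/-- `u(q)⁻¹ ∂_v u(q) ∈ 𝔤`, the left logarithmic derivative of `u : V → G` at `q` along `v`. -/
def leftLog (u : V → G) (q v : V) : E :=
  mfderiv 𝓘(ℝ, V) 𝓘(ℝ, E) (fun s => (u q)⁻¹ * u s) q v

/-- `∂_v u(q) u(q)⁻¹ ∈ 𝔤`, the right logarithmic derivative of `u : V → G` at `q` along `v`. -/
def rightLog (u : V → G) (q v : V) : E :=
  mfderiv 𝓘(ℝ, V) 𝓘(ℝ, E) (fun s => u s * (u q)⁻¹) q v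

/-- `d/dt f(x exp(tX))` at `t = 0`: the derivative of `f : G → ℝ` at `x` along the left-invariant
vector field of `X`. -/
def leftInvDeriv (f : G → ℝ) (X : E) (x : G) : ℝ :=
  mfderiv 𝓘(ℝ, E) 𝓘(ℝ, ℝ) (fun y => f (x * y)) (1 : G) X

/-- One-parameter subgroups of `G`. -/
def IsOneParam (γ : ℝ → G) : Prop :=
  ContMDiff 𝓘(ℝ, ℝ) 𝓘(ℝ, E) ∞ γ ∧ ∀ s t, γ (s + t) = γ s * γ t

variable (G) in
/-- The connected subgroup `G_R` of `D = G × G` with Lie algebra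
`𝔤_R = {(R⁺X, R⁻X) | X ∈ 𝔤} ⊆ 𝔡 = 𝔤 ⊕ 𝔤`: the subgroup generated by `exp 𝔤_R`. -/
def GR (R : E →ₗ[ℝ] E) : Subgroup (G × G) :=
  Subgroup.closure {d | ∃ (X : E) (γp γm : ℝ → G), IsOneParam (E := E) γp ∧
    IsOneParam (E := E) γm ∧ leftLog γp 0 1 = Rplus R X ∧ leftLog γm 0 1 = Rminus R X ∧
    d = (γp 1, γm 1)}

/-- `(xp, xm)` is a smooth map from `V` to the Lie group `G_R`. Here `G_R` has its own Lie group
structure, that of an (immersed, possibly not closed) Lie subgroup of `D` with Lie algebra `𝔤_R`;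
smoothness into it means smoothness into `D`, values in `G_R`, and derivatives tangent to `G_R`,
that is, right logarithmic derivatives in `𝔤_R`. -/
structure IsSmoothGR (R : E →ₗ[ℝ] E) (xp xm : V → G) : Prop where
  smooth_p : ContMDiff 𝓘(ℝ, V) 𝓘(ℝ, E) ∞ xp
  smooth_m : ContMDiff 𝓘(ℝ, V) 𝓘(ℝ, E) ∞ xm
  mem : ∀ q, (xp q, xm q) ∈ GR G R
  tangent : ∀ q v, ∃ Y : E, rightLog xp q v = Rplus R Y ∧ rightLog xm q v = Rminus R Y

end Maps

section PhaseSpace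

variable {E : Type*} [NormedAddCommGroup E] [NormedSpace ℝ E]
  {G : Type*} [TopologicalSpace G] [ChartedSpace E G] [Group G]

variable (G) in
/-- A point of the phase space: a smooth `D`-valued field `Ψ = (Ψ⁺, Ψ⁻)` in the main cell
`G^δ G_R`, with its factorisation `Ψ^± = g x_±`, `g` valued in `G` and `(x_+, x_-)` in `G_R`. As
`Ψ` is only quasi-periodic around the circle in general, fields are functions of the lifted
coordinate `θ ∈ ℝ`. -/
structure FactorisedField (R : E →ₗ[ℝ] E) where
  psip : ℝ → G
  psim : ℝ → G
  g : ℝ → G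
  xp : ℝ → G
  xm : ℝ → G
  smooth_g : ContMDiff 𝓘(ℝ, ℝ) 𝓘(ℝ, E) ∞ g
  smooth_x : IsSmoothGR R xp xm
  fact_p : ∀ θ, psip θ = g θ * xp θ
  fact_m : ∀ θ, psim θ = g θ * xm θ

/-- A smooth curve `t ↦ Ψ_t` in phase space starting at `p`. -/
structure IsVariation {R : E →ₗ[ℝ] E} (γ : ℝ → FactorisedField G R) (p : FactorisedField G R) :
    Prop where
  start : γ 0 = p
  smooth_g : ContMDiff 𝓘(ℝ, ℝ × ℝ) 𝓘(ℝ, E) ∞ (fun q : ℝ × ℝ => (γ q.1).g q.2)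
  smooth_x : IsSmoothGR R (fun q : ℝ × ℝ => (γ q.1).xp q.2) (fun q : ℝ × ℝ => (γ q.1).xm q.2)

/-- Test functions on the circle cut at `a`: smooth functions of `θ` with compact support in the
fundamental domain `(a, a + 2π)`. -/
structure IsTest {F : Type*} [NormedAddCommGroup F] [NormedSpace ℝ F] (a : ℝ) (φ : ℝ → F) :
    Prop where
  smooth : ContDiff ℝ ∞ φ
  compact : HasCompactSupport φ
  support : tsupport φ ⊆ Set.Ioo a (a + 2 * Real.pi)

/-- The functional `F` on phase space has at `p` the (smooth) functional derivative `(Ap, Am)` with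
respect to `Ψ = (Ψ⁺, Ψ⁻)`: along every variation,
`δF = ∫ ⟨Ap, (Ψ⁺)⁻¹ δΨ⁺⟩ + ⟨Am, (Ψ⁻)⁻¹ δΨ⁻⟩ dθ`.
There is at most one such pair, since `Ψ⁻¹ δΨ` can be prescribed arbitrarily. -/
structure HasGradient (B : LinearMap.BilinForm ℝ E) {R : E →ₗ[ℝ] E} (a : ℝ)
    (F : FactorisedField G R → ℝ) (Ap Am : ℝ → E) (p : FactorisedField G R) : Prop where
  test_p : IsTest a Ap
  test_m : IsTest a Am
  deriv : ∀ γ : ℝ → FactorisedField G R, IsVariation γ p →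
    HasDerivAt (fun t => F (γ t))
      (∫ θ, (B (Ap θ) (leftLog (fun t => (γ t).psip θ) 0 1)
        + B (Am θ) (leftLog (fun t => (γ t).psim θ) 0 1))) 0

/-- The stair-step function: `H_{θθ'} = n` for `2πn < θ - θ' < 2π(n+1)`. -/
def stair (θ θ' : ℝ) : ℝ := (⌊(θ - θ') / (2 * Real.pi)⌋ : ℝ)

/-- The contraction of `R⁺₁₂ H_{θθ'} + R⁻₁₂ H_{θ'θ}` with `X` in the first and `Y` in the second
tensor factor. The kernel `A₁₂ ∈ 𝔤 ⊗ 𝔤` of `A ∈ End 𝔤` has contraction `⟨X, A Y⟩`. -/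
def exchangeKernel (B : LinearMap.BilinForm ℝ E) (R : E →ₗ[ℝ] E) (θ θ' : ℝ) (X Y : E) : ℝ :=
  B X (Rplus R Y) * stair θ θ' + B X (Rminus R Y) * stair θ' θ

/-- `{F₁, F₂}(p) = v` for the Poisson bracket on functionals of `Ψ` which is given by the exchange
algebra `{Ψ^±₁(θ), Ψ^±₂(θ')} = ± υ_± Ψ^±₁(θ) Ψ^±₂(θ') (R⁺₁₂ H_{θθ'} + R⁻₁₂ H_{θ'θ})`,
`{Ψ⁺₁(θ), Ψ⁻₂(θ')} = 0`: the functional derivatives of `F₁` and `F₂` are contracted with these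
brackets. -/
def HasBracket (B : LinearMap.BilinForm ℝ E) {R : E →ₗ[ℝ] E} (υp υm a : ℝ)
    (F₁ F₂ : FactorisedField G R → ℝ) (p : FactorisedField G R) (v : ℝ) : Prop :=
  ∃ Ap Am Cp Cm : ℝ → E, HasGradient B a F₁ Ap Am p ∧ HasGradient B a F₂ Cp Cm p ∧
    v = υp * (∫ θ, ∫ θ', exchangeKernel B R θ θ' (Ap θ) (Cp θ'))
      - υm * (∫ θ, ∫ θ', exchangeKernel B R θ θ' (Am θ) (Cm θ'))

/-- The field `𝒥 = ½ (υ_+⁻¹ ∂x_+ x_+⁻¹ - υ_-⁻¹ ∂x_- x_-⁻¹)`. -/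
def currentJ {R : E →ₗ[ℝ] E} (υp υm : ℝ) (p : FactorisedField G R) (θ : ℝ) : E :=
  (1 / 2 : ℝ) • (υp⁻¹ • rightLog p.xp θ 1 - υm⁻¹ • rightLog p.xm θ 1)

/-- The observable `∫ φ(θ) f(g(θ)) dθ`, for `f : G → ℝ`. -/
def obsG {R : E →ₗ[ℝ] E} (f : G → ℝ) (φ : ℝ → ℝ) (p : FactorisedField G R) : ℝ :=
  ∫ θ, φ θ * f (p.g θ)

/-- The observable `∫ ⟨φ(θ), 𝒥(θ)⟩ dθ`. -/
def obsJ (B : LinearMap.BilinForm ℝ E) {R : E →ₗ[ℝ] E} (υp υm : ℝ) (φ : ℝ → E)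
    (p : FactorisedField G R) : ℝ :=
  ∫ θ, B (φ θ) (currentJ υp υm p θ)

/-- The Poisson brackets of `T^*LG` with central term `κ`, at the point `p`, in smeared form:
* `{g₁(θ), g₂(θ')} = 0`,
* `{𝒥₁(θ), g₂(θ')} = g₂(θ) C₁₂ δ_{θθ'}`,
* `{𝒥₁(θ), 𝒥₂(θ')} = - [C₁₂, 𝒥₂(θ)] δ_{θθ'} - κ C₁₂ δ'_{θθ'}`.

Smooth functions `f`, `h` on `G` play the role of the matrix coefficients; `C₁₂` contracted with
`X` in one factor is `X` in the other; `δ'` is the derivative of `δ` in `θ`, so that contracting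
the last term with `φ₁(θ)` and `ψ₂(θ')` gives `+ κ ∫ ⟨φ', ψ⟩`. For `κ = 0` these are the canonical
brackets. -/
structure CotangentBrackets (B : LinearMap.BilinForm ℝ E) {R : E →ₗ[ℝ] E} (υp υm κ a : ℝ)
    (p : FactorisedField G R) : Prop where
  gg : ∀ (f h : G → ℝ) (φ ψ : ℝ → ℝ), ContMDiff 𝓘(ℝ, E) 𝓘(ℝ, ℝ) ∞ f →
    ContMDiff 𝓘(ℝ, E) 𝓘(ℝ, ℝ) ∞ h → IsTest a φ → IsTest a ψ →
    HasBracket B υp υm a (obsG f φ) (obsG h ψ) p 0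
  Jg : ∀ (φ : ℝ → E) (f : G → ℝ) (ψ : ℝ → ℝ), ContMDiff 𝓘(ℝ, E) 𝓘(ℝ, ℝ) ∞ f →
    IsTest a φ → IsTest a ψ →
    HasBracket B υp υm a (obsJ B υp υm φ) (obsG f ψ) p
      (∫ θ, ψ θ * leftInvDeriv f (φ θ) (p.g θ))
  JJ : ∀ φ ψ : ℝ → E, IsTest a φ → IsTest a ψ →
    HasBracket B υp υm a (obsJ B υp υm φ) (obsJ B υp υm ψ) p
      (-(∫ θ, B (lieBr G (φ θ) (currentJ υp υm p θ)) (ψ θ))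
        + κ * ∫ θ, B (deriv φ θ) (ψ θ))

end PhaseSpace

end RealBranch

end

open scoped Manifold ContDiff

noncomputable section

/-! Write ε = g⁻¹δg and δx_± x_±⁻¹ = R^±Y. The factorisation gives Ad(x_±)((Ψ^±)⁻¹δΨ^±) = η_± with
η_± = ε + R^±Y, hence η_+ − η_- = 2Y and R⁺η_- − R⁻η_+ = 2ε. Since the form is Ad-invariant on
connected G, the functional derivatives of f(g) and of 𝒥 can be read off (`hasGradient_obsG`,
`hasGradient_obsJ`); for 𝒥 the Maurer-Cartan equation and one integration by parts are needed.

Bracket of g with g. The Yang-Baxter equation makes 𝔤_R a subalgebra, so Ad of G_R preserves it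
(`IsSplitRMatrix.exists_Ad`) and the gradients of f(g) have the form R^±Z in the frame of Ψ^±. For L
commuting with R, ⟨R⁺Z, L R⁺Z'⟩ = −⟨Z, (R² − 1)L Z'⟩ = ⟨R⁻Z, L R⁻Z'⟩. The two chiral halves
therefore contribute equally, and the bracket is (υ_+ − υ_-) times a contraction containing R² − 1.
It vanishes for equal levels or R² = 1. Otherwise one of (R² − 1)R^± is nonzero, and localising on θ
< θ' or θ' < θ isolates the corresponding kernel (`exists_bracket_ne_zero`).

Brackets with 𝒥. In the cut interval the exchange kernel is a step function, so the Hamiltonian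
vector field S_± of ∫⟨φ, 𝒥⟩ satisfies a first-order ODE with explicit values at both ends. The
central claim (`exists_hamiltonian_obsJ`) is that it moves g by ε = φ: paired with a G_R-transported
constant vector, ε − φ has zero derivative (`IsSplitRMatrix.form_currentGrad`), and the end values
force the constant to be zero. The bracket with g follows at once. For two currents, the bracket
density differs from the asserted one by the derivative of a compactly supported function. -/

namespace RealBranch

open Filter Topology Set

/-! ### Logarithmic derivatives and Ad in the chart at the unit -/

section Geometry

variable {E : Type*} [NormedAddCommGroup E] [NormedSpace ℝ E]
  {G : Type*} [TopologicalSpace G] [ChartedSpace E G] [Group G]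
  {V : Type*} [NormedAddCommGroup V] [NormedSpace ℝ V]

/-- The preferred chart at the unit. -/
def oneChart (x : G) : E := extChartAt 𝓘(ℝ, E) (1 : G) x

variable (G) in
/-- The inverse of the preferred chart at the unit. -/
def oneChartSymm (a : E) : G := (extChartAt 𝓘(ℝ, E) (1 : G)).symm a

variable (G) in
/-- The coordinates of the unit. -/
def oneCoord : E := oneChart (1 : G)

@[simp] lemma oneChartSymm_oneCoord : oneChartSymm G (oneCoord G : E) = 1 :=
  extChartAt_to_inv (I := 𝓘(ℝ, E)) (1 : G)

lemma contMDiffAt_oneChart [IsManifold 𝓘(ℝ, E) ∞ G] :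
    ContMDiffAt 𝓘(ℝ, E) 𝓘(ℝ, E) ∞ (oneChart (E := E)) (1 : G) :=
  contMDiffAt_extChartAt

lemma contMDiffAt_oneChartSymm [IsManifold 𝓘(ℝ, E) ∞ G] :
    ContMDiffAt 𝓘(ℝ, E) 𝓘(ℝ, E) ∞ (oneChartSymm G) (oneCoord G : E) :=
  (contMDiffOn_extChartAt_symm (1 : G)).contMDiffAt
    (extChartAt_target_mem_nhds (I := 𝓘(ℝ, E)) (1 : G))

lemma eventually_oneChartSymm_oneChart :
    ∀ᶠ x in 𝓝 (1 : G), oneChartSymm G (oneChart x : E) = x := by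
  filter_upwards [extChartAt_source_mem_nhds (I := 𝓘(ℝ, E)) (1 : G)] with x hx
  exact (extChartAt 𝓘(ℝ, E) (1 : G)).left_inv hx

lemma eventually_oneChart_oneChartSymm :
    ∀ᶠ a in 𝓝 (oneCoord G : E), oneChart (oneChartSymm G a) = a := by
  filter_upwards [extChartAt_target_mem_nhds (I := 𝓘(ℝ, E)) (1 : G)] with x hx
  exact (extChartAt 𝓘(ℝ, E) (1 : G)).right_inv hx

/-- The velocity at `q` along `v` of a map `f` with `f q = 1`, in the chart at the unit. -/
def velocity (f : V → G) (q v : V) : E := fderiv ℝ (fun s => (oneChart (f s) : E)) q v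

lemma mfderiv_eq_velocity {f : V → G} {q : V} (h : f q = 1)
    (hf : MDifferentiableAt 𝓘(ℝ, V) 𝓘(ℝ, E) f q) (v : V) :
    (mfderiv 𝓘(ℝ, V) 𝓘(ℝ, E) f q v : E) = velocity (E := E) f q v := by
  simp only [mfderiv, hf, writtenInExtChartAt, velocity, oneChart, h]
  simp only [mfld_simps, fderivWithin_univ]
  rfl

variable (G) in
/-- The multiplication of `G` in the chart at the unit. -/
def coordMul (p : E × E) : E := oneChart (oneChartSymm G p.1 * oneChartSymm G p.2)

lemma eventually_coordMul_left :
    ∀ᶠ a in 𝓝 (oneCoord G : E), coordMul G (a, oneCoord G) = a := by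
  filter_upwards [eventually_oneChart_oneChartSymm (G := G)] with a ha
  simp [coordMul, ha]

lemma eventually_coordMul_right :
    ∀ᶠ a in 𝓝 (oneCoord G : E), coordMul G (oneCoord G, a) = a := by
  filter_upwards [eventually_oneChart_oneChartSymm (G := G)] with a ha
  simp [coordMul, ha]

lemma velocity_oneChartSymm (X : E) :
    velocity (oneChartSymm G) (oneCoord G : E) X = X := by
  have h' := (hasFDerivAt_id (𝕜 := ℝ) (oneCoord G : E)).congr_of_eventuallyEq
      (eventually_oneChart_oneChartSymm (G := G))
  unfold velocity
  rw [h'.fderiv]; rfl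

variable [LieGroup 𝓘(ℝ, E) ∞ G]

lemma contMDiff_fun_mul {u w : V → G} (hu : ContMDiff 𝓘(ℝ, V) 𝓘(ℝ, E) ∞ u)
    (hw : ContMDiff 𝓘(ℝ, V) 𝓘(ℝ, E) ∞ w) :
    ContMDiff 𝓘(ℝ, V) 𝓘(ℝ, E) ∞ (fun s => u s * w s) := hu.mul hw

lemma contMDiff_fun_mul_const {u : V → G} (hu : ContMDiff 𝓘(ℝ, V) 𝓘(ℝ, E) ∞ u) (x : G) :
    ContMDiff 𝓘(ℝ, V) 𝓘(ℝ, E) ∞ (fun s => u s * x) := hu.mul contMDiff_const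

lemma contMDiffAt_fun_conj {u : V → G} {q : V} (hu : ContMDiffAt 𝓘(ℝ, V) 𝓘(ℝ, E) ∞ u q) (x : G) :
    ContMDiffAt 𝓘(ℝ, V) 𝓘(ℝ, E) ∞ (fun s => x * u s * x⁻¹) q :=
  (contMDiffAt_const.mul hu).mul contMDiffAt_const

lemma contDiffAt_oneChart_comp {f : V → G} {q : V} (h : f q = 1)
    (hf : ContMDiffAt 𝓘(ℝ, V) 𝓘(ℝ, E) ∞ f q) :
    ContDiffAt ℝ ∞ (fun s => (oneChart (f s) : E)) q := by
  rw [← contMDiffAt_iff_contDiffAt]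
  refine ContMDiffAt.comp (g := (oneChart : G → E)) (I' := 𝓘(ℝ, E)) q ?_ hf
  rw [h]
  exact contMDiffAt_oneChart

lemma leftLog_eq_velocity {u : V → G} (hu : ContMDiff 𝓘(ℝ, V) 𝓘(ℝ, E) ∞ u) (q v : V) :
    (leftLog u q v : E) = velocity (fun s => (u q)⁻¹ * u s) q v :=
  mfderiv_eq_velocity (by simp)
    ((contMDiff_const.mul hu).mdifferentiable (by simp) q) v

lemma rightLog_eq_velocity {u : V → G} (hu : ContMDiff 𝓘(ℝ, V) 𝓘(ℝ, E) ∞ u) (q v : V) :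
    (rightLog u q v : E) = velocity (fun s => u s * (u q)⁻¹) q v :=
  mfderiv_eq_velocity (by simp)
    ((hu.mul contMDiff_const).mdifferentiable (by simp) q) v

variable (G) in
lemma contDiffAt_coordMul :
    ContDiffAt ℝ ∞ (coordMul G) ((oneCoord G, oneCoord G) : E × E) := by
  refine contDiffAt_oneChart_comp (by simp) ?_
  have h1 : ContMDiffAt 𝓘(ℝ, E × E) 𝓘(ℝ, E) ∞ (fun p : E × E => oneChartSymm G p.1)
      (oneCoord G, oneCoord G) :=
    ContMDiffAt.comp (g := oneChartSymm G) (f := Prod.fst) (I' := 𝓘(ℝ, E)) _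
      contMDiffAt_oneChartSymm contDiff_fst.contMDiff.contMDiffAt
  have h2 : ContMDiffAt 𝓘(ℝ, E × E) 𝓘(ℝ, E) ∞ (fun p : E × E => oneChartSymm G p.2)
      (oneCoord G, oneCoord G) :=
    ContMDiffAt.comp (g := oneChartSymm G) (f := Prod.snd) (I' := 𝓘(ℝ, E)) _
      contMDiffAt_oneChartSymm contDiff_snd.contMDiff.contMDiffAt
  exact h1.mul h2

/-- The unit is neutral on both sides, so each partial derivative of the multiplication is the
identity. -/
lemma fderiv_coordMul (X Y : E) :
    fderiv ℝ (coordMul G) (oneCoord G, oneCoord G) (X, Y) = X + Y := by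
  have hd := (contDiffAt_coordMul (E := E) G).differentiableAt (by simp)
  have h1 : fderiv ℝ (coordMul G) (oneCoord G, oneCoord G) (X, 0) = X := by
    have h := HasFDerivAt.comp (oneCoord G : E) (f := fun a : E => (a, (oneCoord G : E)))
      hd.hasFDerivAt ((hasFDerivAt_id _).prodMk (hasFDerivAt_const _ _))
    have h' := (hasFDerivAt_id (𝕜 := ℝ) (oneCoord G : E)).congr_of_eventuallyEq
      (eventually_coordMul_left (G := G))
    simpa using DFunLike.congr_fun (h.unique h') X
  have h2 : fderiv ℝ (coordMul G) (oneCoord G, oneCoord G) (0, Y) = Y := by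
    have h := HasFDerivAt.comp (oneCoord G : E) (f := fun a : E => ((oneCoord G : E), a))
      hd.hasFDerivAt ((hasFDerivAt_const _ _).prodMk (hasFDerivAt_id _))
    have h' := (hasFDerivAt_id (𝕜 := ℝ) (oneCoord G : E)).congr_of_eventuallyEq
      (eventually_coordMul_right (G := G))
    simpa using DFunLike.congr_fun (h.unique h') Y
  have : ((X, Y) : E × E) = (X, 0) + (0, Y) := by simp
  rw [this, map_add, h1, h2]

lemma velocity_mul {f h : V → G} {q : V} (hf1 : f q = 1) (hh1 : h q = 1)
    (hf : ContMDiffAt 𝓘(ℝ, V) 𝓘(ℝ, E) ∞ f q) (hh : ContMDiffAt 𝓘(ℝ, V) 𝓘(ℝ, E) ∞ h q) (v : V) :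
    (velocity (fun s => f s * h s) q v : E) = velocity f q v + velocity h q v := by
  have hF := ((contDiffAt_oneChart_comp hf1 hf).differentiableAt (by simp)).hasFDerivAt
  have hH := ((contDiffAt_oneChart_comp hh1 hh).differentiableAt (by simp)).hasFDerivAt
  have hd := (contDiffAt_coordMul (E := E) G).differentiableAt (by simp)
  have hd' : DifferentiableAt ℝ (coordMul G) ((oneChart (f q) : E), (oneChart (h q) : E)) := by
    rw [hf1, hh1]; exact hd
  have key := hd'.hasFDerivAt.comp q (hF.prodMk hH)
  have ev : (fun s => (oneChart (f s * h s) : E)) =ᶠ[𝓝 q]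
      coordMul G ∘ fun s => ((oneChart (f s) : E), (oneChart (h s) : E)) := by
    have e1 := hf.continuousAt.eventually (hf1 ▸ eventually_oneChartSymm_oneChart (E := E))
    have e2 := hh.continuousAt.eventually (hh1 ▸ eventually_oneChartSymm_oneChart (E := E))
    filter_upwards [e1, e2] with s h1 h2
    simp [coordMul, h1, h2]
  have := (key.congr_of_eventuallyEq ev).fderiv
  unfold velocity
  rw [this]
  simp only [ContinuousLinearMap.comp_apply, ContinuousLinearMap.prod_apply]
  rw [hf1, hh1]
  exact fderiv_coordMul _ _

/-- The adjoint action of `G` on `𝔤`. -/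
def Ad (x : G) : E →L[ℝ] E :=
  fderiv ℝ (fun a : E => (oneChart (x * oneChartSymm G a * x⁻¹) : E)) (oneCoord G : E)

lemma contDiffAt_conj (x : G) :
    ContDiffAt ℝ ∞ (fun a : E => (oneChart (x * oneChartSymm G a * x⁻¹) : E)) (oneCoord G : E) := by
  refine contDiffAt_oneChart_comp (by simp) ?_
  exact contMDiffAt_fun_conj contMDiffAt_oneChartSymm x

lemma velocity_conj {f : V → G} {q : V} (hf1 : f q = 1)
    (hf : ContMDiffAt 𝓘(ℝ, V) 𝓘(ℝ, E) ∞ f q) (x : G) (v : V) :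
    (velocity (fun s => x * f s * x⁻¹) q v : E) = Ad x (velocity f q v) := by
  have hF := ((contDiffAt_oneChart_comp hf1 hf).differentiableAt (by simp)).hasFDerivAt
  have hd : DifferentiableAt ℝ (fun a : E => (oneChart (x * oneChartSymm G a * x⁻¹) : E))
      (oneChart (f q) : E) := by
    rw [hf1]; exact (contDiffAt_conj x).differentiableAt (by simp)
  have key := hd.hasFDerivAt.comp q hF
  have ev : (fun s => (oneChart (x * f s * x⁻¹) : E)) =ᶠ[𝓝 q]
      (fun a : E => (oneChart (x * oneChartSymm G a * x⁻¹) : E)) ∘ fun s => (oneChart (f s) : E) := by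
    have e1 := hf.continuousAt.eventually (hf1 ▸ eventually_oneChartSymm_oneChart (E := E))
    filter_upwards [e1] with s h1
    simp [h1]
  have := (key.congr_of_eventuallyEq ev).fderiv
  unfold velocity Ad
  rw [this]
  simp only [ContinuousLinearMap.comp_apply]
  rw [hf1]
  rfl

omit [LieGroup 𝓘(ℝ, E) ∞ G] in
@[simp] lemma Ad_one : Ad (1 : G) = ContinuousLinearMap.id ℝ E := by
  ext X
  have := velocity_oneChartSymm (G := G) X
  simpa [Ad, velocity] using this

lemma Ad_mul (x y : G) (X : E) : Ad (x * y) X = Ad x (Ad y X) := by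
  have hs := contMDiffAt_oneChartSymm (E := E) (G := G)
  have h1 := velocity_conj (E := E) (q := (oneCoord G : E)) (by simp) hs y X
  have h2 := velocity_conj (E := E) (q := (oneCoord G : E)) (f := fun a => y * oneChartSymm G a * y⁻¹)
    (by simp) (contMDiffAt_fun_conj hs y) x X
  have h3 := velocity_conj (E := E) (q := (oneCoord G : E)) (by simp) hs (x * y) X
  rw [velocity_oneChartSymm] at h1 h3
  rw [h1] at h2
  rw [← h2, ← h3]
  congr 1
  ext s
  simp [mul_assoc]

@[simp] lemma Ad_inv_Ad (x : G) (X : E) : Ad x⁻¹ (Ad x X) = X := by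
  rw [← Ad_mul]; simp

@[simp] lemma Ad_Ad_inv (x : G) (X : E) : Ad x (Ad x⁻¹ X) = X := by
  rw [← Ad_mul]; simp

lemma rightLog_mul {u w : V → G} (hu : ContMDiff 𝓘(ℝ, V) 𝓘(ℝ, E) ∞ u)
    (hw : ContMDiff 𝓘(ℝ, V) 𝓘(ℝ, E) ∞ w) (q v : V) :
    (rightLog (fun s => u s * w s) q v : E) = rightLog u q v + Ad (u q) (rightLog w q v) := by
  rw [rightLog_eq_velocity hu, rightLog_eq_velocity hw, rightLog_eq_velocity (contMDiff_fun_mul hu hw)]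
  have hw' : ContMDiffAt 𝓘(ℝ, V) 𝓘(ℝ, E) ∞ (fun s => w s * (w q)⁻¹) q :=
    contMDiff_fun_mul_const hw _ q
  rw [← velocity_conj (by simp) hw', ← velocity_mul (by simp) (by simp)
    (contMDiff_fun_mul_const hu _ q) (contMDiffAt_fun_conj hw' _)]
  congr 1
  ext s
  group

lemma leftLog_eq_Ad_rightLog {u : V → G} (hu : ContMDiff 𝓘(ℝ, V) 𝓘(ℝ, E) ∞ u) (q v : V) :
    (leftLog u q v : E) = Ad (u q)⁻¹ (rightLog u q v) := by
  rw [rightLog_eq_velocity hu, leftLog_eq_velocity hu, ← velocity_conj (by simp)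
    (contMDiff_fun_mul_const hu _ q)]
  congr 1
  ext s
  group

/-- Applied to Ψ = g x, this form keeps g⁻¹δg and δx x⁻¹ side by side, with a single outer Ad that
invariance of the form later removes. -/
lemma leftLog_mul {u w : V → G} (hu : ContMDiff 𝓘(ℝ, V) 𝓘(ℝ, E) ∞ u)
    (hw : ContMDiff 𝓘(ℝ, V) 𝓘(ℝ, E) ∞ w) (q v : V) :
    (leftLog (fun s => u s * w s) q v : E) =
      Ad (w q)⁻¹ (leftLog u q v + rightLog w q v) := by
  rw [leftLog_eq_Ad_rightLog hu, leftLog_eq_Ad_rightLog (contMDiff_fun_mul hu hw), rightLog_mul hu hw,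
    mul_inv_rev, Ad_mul]
  simp

/-- The logarithmic derivative is a partial derivative, on the diagonal s = q, of u(s) u(q)⁻¹. That
map equals 1 there, so one fixed chart serves all q. -/
lemma contDiff_rightLog {u : V → G} (hu : ContMDiff 𝓘(ℝ, V) 𝓘(ℝ, E) ∞ u) (v : V) :
    ContDiff ℝ ∞ (fun q => (rightLog u q v : E)) := by
  simp_rw [rightLog_eq_velocity hu]
  rw [contDiff_iff_contDiffAt]
  intro q
  have h : ContDiffAt ℝ ∞ (Function.uncurry fun q s : V => (oneChart (u s * (u q)⁻¹) : E))
      (q, q) := by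
    refine contDiffAt_oneChart_comp (by simp) ?_
    have h1 : ContMDiff 𝓘(ℝ, V × V) 𝓘(ℝ, E) ∞ (fun p : V × V => u p.2) :=
      hu.comp contDiff_snd.contMDiff
    have h2 : ContMDiff 𝓘(ℝ, V × V) 𝓘(ℝ, E) ∞ (fun p : V × V => (u p.1)⁻¹) :=
      (hu.comp contDiff_fst.contMDiff).inv
    exact (h1.mul h2) _
  exact (ContDiffAt.fderiv h contDiffAt_id (by simp)).clm_apply contDiffAt_const

end Geometry

end RealBranch

end

noncomputable section

namespace RealBranch

open Filter Topology Set

/-! ### The Lie bracket as a second derivative of the multiplication; Maurer-Cartan -/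

section Bracket

variable {E : Type*} [NormedAddCommGroup E] [NormedSpace ℝ E]
  {G : Type*} [TopologicalSpace G] [ChartedSpace E G] [Group G]
  {V : Type*} [NormedAddCommGroup V] [NormedSpace ℝ V]

lemma minSmoothness_two_le_infty : minSmoothness ℝ 2 ≤ (∞ : WithTop ℕ∞) := by
  rw [minSmoothness_of_isRCLikeNormedField]
  exact WithTop.coe_le_coe.mpr le_top

lemma mfderiv_eq_fderiv_oneChartSymm {F : G → V} (hF : MDifferentiableAt 𝓘(ℝ, E) 𝓘(ℝ, V) F 1)
    (X : E) :
    (mfderiv 𝓘(ℝ, E) 𝓘(ℝ, V) F 1 X : V) =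
      fderiv ℝ (fun a => F (oneChartSymm G a)) (oneCoord G : E) X := by
  simp only [mfderiv, hF, writtenInExtChartAt, oneChartSymm, oneCoord, oneChart]
  simp only [mfld_simps, fderivWithin_univ]
  rfl

variable [LieGroup 𝓘(ℝ, E) ∞ G]

lemma eventually_differentiableAt_coordMul :
    ∀ᶠ p in 𝓝 ((oneCoord G, oneCoord G) : E × E), DifferentiableAt ℝ (coordMul G) p := by
  have h := ((contDiffAt_coordMul (E := E) G).of_le (m := 1) (by simp)).eventually (by simp)
  filter_upwards [h] with p hp
  exact hp.differentiableAt (by simp)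

/-- The left-invariant field of X is the derivative of right factors: in the chart, ∂₂m(a, e)X for
the coordinate multiplication m. -/
lemma eventually_mpullback_mulInvariantVectorField (X : E) :
    ∀ᶠ a in 𝓝 (oneCoord G : E),
      (VectorField.mpullbackWithin 𝓘(ℝ, E) 𝓘(ℝ, E) (extChartAt 𝓘(ℝ, E) (1 : G)).symm
        (mulInvariantVectorField (I := 𝓘(ℝ, E)) (G := G) X) (range 𝓘(ℝ, E)) a : E) =
      fderiv ℝ (coordMul G) (a, oneCoord G) ((0 : E), X) := by
  have hc : Continuous fun a : E => (a, (oneCoord G : E)) := by fun_prop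
  filter_upwards [extChartAt_target_mem_nhds (I := 𝓘(ℝ, E)) (1 : G),
    hc.continuousAt.eventually (eventually_differentiableAt_coordMul (G := G))] with a ha hd
  have hsrc : (extChartAt 𝓘(ℝ, E) (1 : G)).symm a ∈ (extChartAt 𝓘(ℝ, E) (1 : G)).source :=
    (extChartAt 𝓘(ℝ, E) (1 : G)).map_target ha
  have hinv := ContinuousLinearMap.inverse_eq
    (mfderivWithin_extChartAt_symm_comp_mfderiv_extChartAt ha)
    (mfderiv_extChartAt_comp_mfderivWithin_extChartAt_symm ha)
  rw [VectorField.mpullbackWithin_apply, hinv]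
  set x : G := (extChartAt 𝓘(ℝ, E) (1 : G)).symm a with hx
  have h1 : MDifferentiableAt 𝓘(ℝ, E) 𝓘(ℝ, E) (extChartAt 𝓘(ℝ, E) (1 : G)) (x * 1) := by
    rw [mul_one]
    exact mdifferentiableAt_extChartAt (by simpa using hsrc)
  have h2 : MDifferentiableAt 𝓘(ℝ, E) 𝓘(ℝ, E) (fun y : G => x * y) 1 :=
    (contMDiff_mul_left (n := ∞)).mdifferentiable (by simp) 1
  have h3 := mfderiv_comp_apply (1 : G) (f := fun y : G => x * y) h1 h2 X
  have h4 := mfderiv_eq_fderiv_oneChartSymm (MDifferentiableAt.comp (1 : G)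
    (f := fun y : G => x * y) h1 h2) X
  have h5 : fderiv ℝ (fun b => ((extChartAt 𝓘(ℝ, E) (1 : G)) ∘ fun y : G => x * y)
      (oneChartSymm G b)) (oneCoord G : E) X = fderiv ℝ (coordMul G) (a, oneCoord G) ((0 : E), X) := by
    have h := HasFDerivAt.comp (oneCoord G : E) (f := fun b : E => (a, b))
      hd.hasFDerivAt ((hasFDerivAt_const _ _).prodMk (hasFDerivAt_id _))
    have e : (fun b => ((extChartAt 𝓘(ℝ, E) (1 : G)) ∘ fun y : G => x * y) (oneChartSymm G b)) =
      coordMul G ∘ fun b : E => (a, b) := rfl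
    rw [e, h.fderiv]
    simp
  rw [← h5, ← h4]
  refine Eq.trans ?_ h3.symm
  -- The base points x and x * 1 give different tangent space types, so the equality is transported
  -- with a generic point.
  have h6 : ∀ z : G, z = x → ∀ Z : E, (mfderiv 𝓘(ℝ, E) 𝓘(ℝ, E) (extChartAt 𝓘(ℝ, E) (1 : G)) x Z : E)
      = mfderiv 𝓘(ℝ, E) 𝓘(ℝ, E) (extChartAt 𝓘(ℝ, E) (1 : G)) z Z := by
    rintro z rfl Z; rfl
  exact h6 (x * 1) (mul_one x) _

lemma mfderiv_extChartAt_one (X : E) :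
    (mfderiv 𝓘(ℝ, E) 𝓘(ℝ, E) (extChartAt 𝓘(ℝ, E) (1 : G)) (1 : G) X : E) = X := by
  have h := mfderiv_eq_fderiv_oneChartSymm (F := (extChartAt 𝓘(ℝ, E) (1 : G)))
    (mdifferentiableAt_extChartAt (mem_chart_source E (1 : G))) X
  have h' := velocity_oneChartSymm (G := G) X
  exact h.trans h'

lemma fderiv_coordMul_second (X Y : E) :
    fderiv ℝ (fun a => fderiv ℝ (coordMul G) (a, oneCoord G) ((0 : E), Y)) (oneCoord G : E) X =
      fderiv ℝ (fderiv ℝ (coordMul G)) (oneCoord G, oneCoord G) (X, 0) (0, Y) := by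
  have hd : DifferentiableAt ℝ (fderiv ℝ (coordMul G)) ((oneCoord G, oneCoord G) : E × E) :=
    ((contDiffAt_coordMul (E := E) G).fderiv_right (m := ∞) (by simp)).differentiableAt (by simp)
  have h := HasFDerivAt.comp (oneCoord G : E) (f := fun a : E => (a, (oneCoord G : E)))
      hd.hasFDerivAt ((hasFDerivAt_id _).prodMk (hasFDerivAt_const _ _))
  have h2 := h.clm_apply (hasFDerivAt_const ((0 : E), Y) _)
  have := h2.fderiv
  simp only [Function.comp_def] at this
  rw [this]
  simp

/-- Left-invariant fields read ∂₂m(a, e)X in the chart; the vector-space bracket of two of them at e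
is the antisymmetrised mixed second derivative of m. -/
lemma lieBr_eq (X Y : E) :
    lieBr G X Y = fderiv ℝ (fderiv ℝ (coordMul G)) (oneCoord G, oneCoord G) (X, 0) (0, Y) -
      fderiv ℝ (fderiv ℝ (coordMul G)) (oneCoord G, oneCoord G) (Y, 0) (0, X) := by
  have hX := eventually_mpullback_mulInvariantVectorField (G := G) X
  have hY := eventually_mpullback_mulInvariantVectorField (G := G) Y
  have hb := Filter.EventuallyEq.lieBracket_vectorField_eq (𝕜 := ℝ) hX hY
  have hinv : (mfderiv 𝓘(ℝ, E) 𝓘(ℝ, E) (extChartAt 𝓘(ℝ, E) (1 : G)) (1 : G)).inverse =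
      ContinuousLinearMap.id ℝ E := by
    have : mfderiv 𝓘(ℝ, E) 𝓘(ℝ, E) (extChartAt 𝓘(ℝ, E) (1 : G)) (1 : G) =
      ContinuousLinearMap.id ℝ E := by
      ext Z; exact mfderiv_extChartAt_one (E := E) Z
    rw [this]; exact ContinuousLinearMap.inverse_id
  have hr : range (𝓘(ℝ, E)) = univ := by simp
  have hgen : ∀ (P Q : E → E) (s : Set E), s = univ →
      VectorField.lieBracketWithin ℝ P Q s = VectorField.lieBracket ℝ P Q := by
    rintro P Q s rfl
    exact VectorField.lieBracketWithin_univ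
  have hs : (extChartAt 𝓘(ℝ, E) (1 : G)).symm ⁻¹' univ ∩ range 𝓘(ℝ, E) = univ := by
    rw [hr]; simp
  have hval : VectorField.lieBracket ℝ (fun x : E => fderiv ℝ (coordMul G) (x, oneCoord G) ((0 : E), X))
      (fun x : E => fderiv ℝ (coordMul G) (x, oneCoord G) ((0 : E), Y)) (oneCoord G) =
      fderiv ℝ (fderiv ℝ (coordMul G)) (oneCoord G, oneCoord G) (X, 0) (0, Y) -
      fderiv ℝ (fderiv ℝ (coordMul G)) (oneCoord G, oneCoord G) (Y, 0) (0, X) := by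
    rw [VectorField.lieBracket_eq]
    simp only [fderiv_coordMul_second, fderiv_coordMul, zero_add]
  have hfin := (congrFun (hgen _ _ _ hs) (oneCoord G)).trans (hb.trans hval)
  exact (DFunLike.congr_fun hinv _).trans hfin

/-- The Maurer-Cartan equation for the right logarithmic derivative. -/
lemma maurerCartan {u : V → G} (hu : ContMDiff 𝓘(ℝ, V) 𝓘(ℝ, E) ∞ u) (q v₁ v₂ : V) :
    fderiv ℝ (fun s => (rightLog u s v₂ : E)) q v₁ - fderiv ℝ (fun s => (rightLog u s v₁ : E)) q v₂
      = lieBr G (rightLog u q v₁ : E) (rightLog u q v₂) := by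
  set b : E × E →L[ℝ] E × E →L[ℝ] E :=
    fderiv ℝ (fderiv ℝ (coordMul G)) (oneCoord G, oneCoord G) with hb
  have hbsymm : ∀ p p', b p p' = b p' p := by
    intro p p'
    exact ((contDiffAt_coordMul (E := E) G).isSymmSndFDerivAt minSmoothness_two_le_infty).eq p p'
  set w : V → G := fun s => u s * (u q)⁻¹ with hw
  have hwq : w q = 1 := by simp [hw]
  have hws : ContMDiff 𝓘(ℝ, V) 𝓘(ℝ, E) ∞ w := contMDiff_fun_mul_const hu _
  have hwC : ContDiffAt ℝ ∞ (fun s => (oneChart (w s) : E)) q :=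
    contDiffAt_oneChart_comp hwq (hws q)
  set c : V → E := fun s => oneChart (w s) with hcdef
  have hcq : c q = oneCoord G := by simp [hcdef, hwq, oneCoord]
  have hcsymm := hwC.isSymmSndFDerivAt minSmoothness_two_le_infty
  -- the logarithmic derivative in the chart
  have key : ∀ v, ∀ᶠ s in 𝓝 q, fderiv ℝ c s v =
      fderiv ℝ (coordMul G) (oneCoord G, c s) ((rightLog u s v : E), 0) := by
    intro v
    have hc : ContinuousAt (fun s => ((oneCoord G : E), c s)) q :=
      continuousAt_const.prodMk hwC.continuousAt
    have e1 := hc.eventually (p := fun p => DifferentiableAt ℝ (coordMul G) p) (by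
      simp only [hcq]; exact eventually_differentiableAt_coordMul (G := G))
    have e2 : ∀ᶠ s in 𝓝 q, ∀ᶠ r in 𝓝 s, oneChartSymm G (c r) = w r :=
      ((hws q).continuousAt.eventually (by rw [hwq]; exact eventually_oneChartSymm_oneChart (E := E))).eventually_nhds
    filter_upwards [e1, e2] with s hs1 hs2
    have hr : ContMDiff 𝓘(ℝ, V) 𝓘(ℝ, E) ∞ (fun r => u r * (u s)⁻¹) :=
      contMDiff_fun_mul_const hu _
    have hrC := contDiffAt_oneChart_comp (E := E) (q := s) (by simp) (hr s)
    have hrd := (hrC.differentiableAt (by simp)).hasFDerivAt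
    have e3 : ∀ᶠ r in 𝓝 s, oneChartSymm G (oneChart (u r * (u s)⁻¹) : E) = u r * (u s)⁻¹ :=
      (hr s).continuousAt.eventually (by simpa using eventually_oneChartSymm_oneChart (E := E))
    -- This is u(r)u(q)⁻¹ = (u(r)u(s)⁻¹)(u(s)u(q)⁻¹): only the first factor varies with r, and its
    -- velocity at r = s is the right logarithmic derivative.
    have ev : c =ᶠ[𝓝 s] coordMul G ∘ fun r => ((oneChart (u r * (u s)⁻¹) : E), c s) := by
      filter_upwards [e3] with r hr3
      simp only [Function.comp, coordMul, hr3, hs2.self_of_nhds]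
      simp [hcdef, hw]
    have hs1' : DifferentiableAt ℝ (coordMul G) ((oneChart (u s * (u s)⁻¹) : E), c s) := by
      rw [mul_inv_cancel]; exact hs1
    have := (HasFDerivAt.comp s (f := fun r => ((oneChart (u r * (u s)⁻¹) : E), c s))
      hs1'.hasFDerivAt (hrd.prodMk (hasFDerivAt_const _ _))).congr_of_eventuallyEq ev
    rw [this.fderiv, rightLog_eq_velocity hu]
    simp [velocity, oneCoord]
  have hrl : ∀ v, DifferentiableAt ℝ (fun s => (rightLog u s v : E)) q := fun v =>
    (contDiff_rightLog hu v).differentiable (by simp) q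
  have hrq : ∀ v, fderiv ℝ c q v = rightLog u q v := by
    intro v
    rw [(key v).self_of_nhds, hcq, fderiv_coordMul, add_zero]
  -- Differentiating `key` at q: one term from the moving point c(s), one from the moving
  -- logarithmic derivative.
  have main : ∀ v v', fderiv ℝ (fderiv ℝ c) q v' v =
      b (0, rightLog u q v') (rightLog u q v, 0) +
        fderiv ℝ (fun s => (rightLog u s v : E)) q v' := by
    intro v v'
    have hd : DifferentiableAt ℝ (fderiv ℝ (coordMul G)) ((oneCoord G, c q) : E × E) := by
      rw [hcq]
      exact ((contDiffAt_coordMul (E := E) G).fderiv_right (m := ∞) (by simp)).differentiableAt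
        (by simp)
    have hcd := (hwC.differentiableAt (by simp)).hasFDerivAt
    have h1 := (HasFDerivAt.comp q (f := fun s => ((oneCoord G : E), c s)) hd.hasFDerivAt
      ((hasFDerivAt_const _ _).prodMk hcd)).clm_apply
      ((hrl v).hasFDerivAt.prodMk (hasFDerivAt_const (0 : E) _))
    have h2 := h1.congr_of_eventuallyEq (key v)
    have hc2 : DifferentiableAt ℝ (fderiv ℝ c) q :=
      (hwC.fderiv_right (m := ∞) (by simp)).differentiableAt (by simp)
    have h3 := hc2.hasFDerivAt.clm_apply (hasFDerivAt_const v q)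
    have h4 := DFunLike.congr_fun (h3.unique h2) v'
    simp only [add_apply, ContinuousLinearMap.comp_apply,
      ContinuousLinearMap.flip_apply, ContinuousLinearMap.prod_apply,
      zero_apply, map_zero, Function.comp_apply, zero_add] at h4
    rw [h4, hrq, hcq, fderiv_coordMul, add_zero, add_comm]
  rw [lieBr_eq, ← hb]
  have h1 := main v₁ v₂
  have h2 := main v₂ v₁
  -- Symmetry of the second derivative of c equates the two expressions; what remains is the
  -- antisymmetrised b, that is, the bracket.
  rw [hcsymm.eq v₂ v₁, h2] at h1
  rw [hbsymm (rightLog u q v₁, 0), hbsymm (rightLog u q v₂, 0)]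
  linear_combination (norm := module) h1

end Bracket

end RealBranch

end

noncomputable section

namespace RealBranch

open Filter Topology Set

/-! ### Derivative of Ad along curves; invariance of the form under Ad -/

section Adjoint

variable {E : Type*} [NormedAddCommGroup E] [NormedSpace ℝ E]
  {G : Type*} [TopologicalSpace G] [ChartedSpace E G] [Group G]
  {V : Type*} [NormedAddCommGroup V] [NormedSpace ℝ V]
  {W : Type*} [NormedAddCommGroup W] [NormedSpace ℝ W]

variable (G) in
/-- The Lie bracket of `𝔤` as a continuous bilinear map. -/
def adCLM : E →L[ℝ] E →L[ℝ] E :=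
  let c : E →L[ℝ] E →L[ℝ] E :=
    ((ContinuousLinearMap.compL ℝ E (E × E) E).flip (ContinuousLinearMap.inr ℝ E E)) ∘L
      (fderiv ℝ (fderiv ℝ (coordMul G)) (oneCoord G, oneCoord G)) ∘L ContinuousLinearMap.inl ℝ E E
  c - c.flip

variable [LieGroup 𝓘(ℝ, E) ∞ G]

lemma lieBr_eq_adCLM (X Y : E) : lieBr G X Y = adCLM G X Y := by
  rw [lieBr_eq]
  simp [adCLM]

lemma adCLM_swap (X Y : E) : adCLM G X Y = - adCLM G Y X := by
  rw [← lieBr_eq_adCLM, ← lieBr_eq_adCLM, lieBr_eq, lieBr_eq, neg_sub]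

lemma rightLog_comp {u : V → G} (hu : ContMDiff 𝓘(ℝ, V) 𝓘(ℝ, E) ∞ u) {h : W → V}
    (hh : ContDiff ℝ ∞ h) (q v : W) :
    (rightLog (fun s => u (h s)) q v : E) = rightLog u (h q) (fderiv ℝ h q v) := by
  rw [rightLog_eq_velocity hu, rightLog_eq_velocity (u := fun s => u (h s)) (hu.comp hh.contMDiff)]
  have h1 := contDiffAt_oneChart_comp (E := E) (q := h q) (by simp)
    (contMDiff_fun_mul_const hu (u (h q))⁻¹ (h q))
  have h2 := HasFDerivAt.comp q (h1.differentiableAt (by simp)).hasFDerivAt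
    (hh.differentiable (by simp) q).hasFDerivAt
  unfold velocity
  simp only [Function.comp_def] at h2 ⊢
  rw [h2.fderiv]
  rfl

lemma rightLog_const (x : G) (q v : V) : (rightLog (fun _ => x) q v : E) = 0 := by
  rw [rightLog_eq_velocity contMDiff_const]
  simp [velocity]

variable (G) in
lemma exists_ball_oneChartSymm :
    ∃ r : ℝ, 0 < r ∧ (∀ a ∈ Metric.ball (oneCoord G : E) r, oneChart (oneChartSymm G a) = a) ∧
      ∀ a ∈ Metric.ball (oneCoord G : E) r,
        ContMDiffAt 𝓘(ℝ, E) 𝓘(ℝ, E) ∞ (oneChartSymm G) a := by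
  obtain ⟨r, hr, hsub⟩ := Metric.mem_nhds_iff.1
    (extChartAt_target_mem_nhds (I := 𝓘(ℝ, E)) (1 : G))
  refine ⟨r, hr, fun a ha => (extChartAt 𝓘(ℝ, E) (1 : G)).right_inv (hsub ha), fun a ha => ?_⟩
  exact (contMDiffOn_extChartAt_symm (1 : G)).contMDiffAt
    (mem_of_superset (Metric.isOpen_ball.mem_nhds ha) hsub)

variable (G) in
/-- Every vector of `𝔤` is the velocity of a smooth curve through the unit. -/
lemma exists_curve (X : E) : ∃ c : ℝ → G, ContMDiff 𝓘(ℝ, ℝ) 𝓘(ℝ, E) ∞ c ∧ c 0 = 1 ∧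
    (rightLog c 0 1 : E) = X := by
  obtain ⟨r, hr, hinv, hsm⟩ := exists_ball_oneChartSymm (E := E) G
  -- The curve ε sin(s/ε) X has velocity X at 0, and with this ε its norm stays below r / 2 for all
  -- s, so it never leaves the chart ball.
  set ε : ℝ := r / (2 * (‖X‖ + 1)) with hε
  have hX : 0 < ‖X‖ + 1 := by positivity
  have hε0 : 0 < ε := by positivity
  let a : ℝ → E := fun s => oneCoord G + (ε * Real.sin (s / ε)) • X
  have ha : ContDiff ℝ ∞ a :=
    contDiff_const.add ((contDiff_const.mul (Real.contDiff_sin.comp (contDiff_id.div_const _))).smul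
      contDiff_const)
  have hball : ∀ s, a s ∈ Metric.ball (oneCoord G : E) r := by
    intro s
    rw [mem_ball_iff_norm]
    simp only [a, add_sub_cancel_left, norm_smul, norm_mul, Real.norm_eq_abs, abs_of_pos hε0]
    have h1 := Real.abs_sin_le_one (s / ε)
    calc ε * |Real.sin (s / ε)| * ‖X‖ ≤ ε * 1 * (‖X‖ + 1) := by gcongr; linarith
      _ = r / 2 := by rw [hε]; field_simp
      _ < r := by linarith
  have hc : ContMDiff 𝓘(ℝ, ℝ) 𝓘(ℝ, E) ∞ (fun s => oneChartSymm G (a s)) := fun s =>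
    ContMDiffAt.comp s (I' := 𝓘(ℝ, E)) (hsm _ (hball s)) ha.contMDiff.contMDiffAt
  have hc0 : oneChartSymm G (a 0) = 1 := by simp [a]
  refine ⟨_, hc, hc0, ?_⟩
  rw [rightLog_eq_velocity hc]
  simp only [hc0, inv_one, mul_one, velocity]
  have : (fun s => oneChart (oneChartSymm G (a s))) = a := funext fun s => hinv _ (hball s)
  rw [this, fderiv_apply_one_eq_deriv]
  have h1 : HasDerivAt (fun s => Real.sin (s / ε)) (Real.cos (0 / ε) * (1 / ε)) 0 :=
    (Real.hasDerivAt_sin _).comp 0 ((hasDerivAt_id (0 : ℝ)).div_const ε)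
  have h2 := ((h1.const_mul ε).smul_const X).const_add (oneCoord G : E)
  rw [h2.deriv]
  simp [hε0.ne']

/-- Points near the unit are joined to it by smooth curves. -/
lemma eventually_exists_path : ∀ᶠ y in 𝓝 (1 : G), ∃ c : ℝ → G,
    ContMDiff 𝓘(ℝ, ℝ) 𝓘(ℝ, E) ∞ c ∧ c 0 = 1 ∧ c 1 = y := by
  obtain ⟨r, hr, hinv, hsm⟩ := exists_ball_oneChartSymm (E := E) G
  have h1 : ∀ᶠ y in 𝓝 (1 : G), (oneChart y : E) ∈ Metric.ball (oneCoord G : E) r :=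
    (contMDiffAt_oneChart (E := E) (G := G)).continuousAt.eventually (Metric.ball_mem_nhds _ hr)
  filter_upwards [h1, eventually_oneChartSymm_oneChart (E := E)] with y hy hy2
  -- The smooth transition stays in [0, 1], so the curve is globally defined although only its
  -- values on [0, 1] matter.
  let a : ℝ → E := fun s => oneCoord G + Real.smoothTransition s • (oneChart y - oneCoord G)
  have ha : ContDiff ℝ ∞ a :=
    contDiff_const.add (Real.smoothTransition.contDiff.smul contDiff_const)
  have hball : ∀ s, a s ∈ Metric.ball (oneCoord G : E) r := by
    intro s
    rw [mem_ball_iff_norm] at hy ⊢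
    simp only [a, add_sub_cancel_left, norm_smul, Real.norm_eq_abs,
      abs_of_nonneg (Real.smoothTransition.nonneg s)]
    exact (mul_le_of_le_one_left (norm_nonneg _) (Real.smoothTransition.le_one s)).trans_lt hy
  refine ⟨fun s => oneChartSymm G (a s), fun s => ContMDiffAt.comp s (I' := 𝓘(ℝ, E))
    (hsm _ (hball s)) ha.contMDiff.contMDiffAt, ?_, ?_⟩
  · simp [a]
  · simp [a, hy2]

lemma rightLog_mul_curve {u : V → G} (hu : ContMDiff 𝓘(ℝ, V) 𝓘(ℝ, E) ∞ u) {c : ℝ → G}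
    (hc : ContMDiff 𝓘(ℝ, ℝ) 𝓘(ℝ, E) ∞ c) (q : V × ℝ) (v : V × ℝ) :
    (rightLog (fun p : V × ℝ => u p.1 * c p.2) q v : E) =
      rightLog u q.1 v.1 + Ad (u q.1) (rightLog c q.2 v.2) := by
  rw [rightLog_mul (u := fun p : V × ℝ => u p.1) (w := fun p : V × ℝ => c p.2)
    (hu.comp contDiff_fst.contMDiff) (hc.comp contDiff_snd.contMDiff),
    rightLog_comp hu contDiff_fst, rightLog_comp hc contDiff_snd]
  simp [fderiv_fst, fderiv_snd]

lemma contMDiff_mul_curve {u : V → G} (hu : ContMDiff 𝓘(ℝ, V) 𝓘(ℝ, E) ∞ u) {c : ℝ → G}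
    (hc : ContMDiff 𝓘(ℝ, ℝ) 𝓘(ℝ, E) ∞ c) :
    ContMDiff 𝓘(ℝ, V × ℝ) 𝓘(ℝ, E) ∞ (fun p : V × ℝ => u p.1 * c p.2) :=
  contMDiff_fun_mul (hu.comp contDiff_fst.contMDiff) (hc.comp contDiff_snd.contMDiff)

lemma rightLog_zero {u : V → G} (hu : ContMDiff 𝓘(ℝ, V) 𝓘(ℝ, E) ∞ u) (q : V) :
    (rightLog u q 0 : E) = 0 := by
  rw [rightLog_eq_velocity hu]; simp [velocity]

/-- For a curve c through 1 with velocity X, Ad(u(q))X is the right logarithmic derivative of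
u(q)c(t) in t at t = 0, which is already known to be smooth. -/
lemma contDiff_Ad_apply {u : V → G} (hu : ContMDiff 𝓘(ℝ, V) 𝓘(ℝ, E) ∞ u) (X : E) :
    ContDiff ℝ ∞ (fun q => Ad (u q) X) := by
  obtain ⟨c, hc, hc0, hcX⟩ := exists_curve G X
  have h := (contDiff_rightLog (contMDiff_mul_curve hu hc) (0, 1)).comp
    (contDiff_id.prodMk contDiff_const : ContDiff ℝ ∞ (fun q : V => (q, (0 : ℝ))))
  convert h using 2 with q
  simp [rightLog_mul_curve hu hc, rightLog_zero hu, hcX]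

/-- This is the Maurer-Cartan equation for the two-parameter map x(s)c(t), where c has velocity X:
the s-component of the logarithmic derivative does not depend on t, so one of its two derivative
terms drops out. -/
lemma hasDerivAt_Ad_const {x : ℝ → G} (hx : ContMDiff 𝓘(ℝ, ℝ) 𝓘(ℝ, E) ∞ x) (X : E) (s : ℝ) :
    HasDerivAt (fun s => Ad (x s) X) (adCLM G (rightLog x s 1 : E) (Ad (x s) X)) s := by
  obtain ⟨c, hc, hc0, hcX⟩ := exists_curve G X
  have hu := contMDiff_mul_curve hx hc
  have mc := maurerCartan hu (s, 0) (1, 0) (0, 1)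
  simp only [rightLog_mul_curve hx hc, rightLog_zero hx, rightLog_zero hc, hcX, zero_add,
    map_zero, add_zero, lieBr_eq_adCLM] at mc
  have h0 : fderiv ℝ (fun p : ℝ × ℝ => (rightLog x p.1 1 : E)) (s, 0) (0, 1) = 0 := by
    have h := HasFDerivAt.comp ((s, 0) : ℝ × ℝ)
      (((contDiff_rightLog hx 1).differentiable (by simp)) s).hasFDerivAt
      (hasFDerivAt_fst (𝕜 := ℝ) (p := ((s, 0) : ℝ × ℝ)))
    simp only [Function.comp_def] at h
    rw [h.fderiv]; simp
  rw [h0, sub_zero] at mc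
  rw [← mc]
  have hd : DifferentiableAt ℝ (fun p : ℝ × ℝ => Ad (x p.1) (rightLog c p.2 1 : E)) (s, 0) := by
    have := (contDiff_rightLog hu (0, 1)).differentiable (by simp) (s, 0)
    simpa only [rightLog_mul_curve hx hc, rightLog_zero hx, zero_add] using this
  have := HasFDerivAt.comp_hasDerivAt s (f := fun r : ℝ => (r, (0 : ℝ))) hd.hasFDerivAt
    ((hasDerivAt_id s).prodMk (hasDerivAt_const s (0 : ℝ)))
  simpa [Function.comp_def, hcX] using this

lemma IsInvariantForm.adCLM_left {B : LinearMap.BilinForm ℝ E} (hB : IsInvariantForm G B)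
    (X Y Z : E) : B (adCLM G X Y) Z = - B Y (adCLM G X Z) := by
  rw [adCLM_swap, map_neg, LinearMap.neg_apply, ← lieBr_eq_adCLM, hB.invariant, lieBr_eq_adCLM]

variable [FiniteDimensional ℝ E]

lemma contDiff_Ad {u : V → G} (hu : ContMDiff 𝓘(ℝ, V) 𝓘(ℝ, E) ∞ u) :
    ContDiff ℝ ∞ (fun q => (Ad (u q) : E →L[ℝ] E)) :=
  contDiff_clm_apply_iff.2 fun X => contDiff_Ad_apply hu X

lemma hasDerivAt_Ad {x : ℝ → G} (hx : ContMDiff 𝓘(ℝ, ℝ) 𝓘(ℝ, E) ∞ x) {S : ℝ → E} {S' : E} {s : ℝ}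
    (hS : HasDerivAt S S' s) :
    HasDerivAt (fun s => Ad (x s) (S s))
      (adCLM G (rightLog x s 1 : E) (Ad (x s) (S s)) + Ad (x s) S') s := by
  have hA : HasDerivAt (fun s => (Ad (x s) : E →L[ℝ] E))
      (deriv (fun s => (Ad (x s) : E →L[ℝ] E)) s) s :=
    ((contDiff_Ad hx).differentiable (by simp) s).hasDerivAt
  have hval : ∀ X, deriv (fun s => (Ad (x s) : E →L[ℝ] E)) s X =
      adCLM G (rightLog x s 1 : E) (Ad (x s) X) := fun X => by
    have h1 := hA.clm_apply (hasDerivAt_const s X)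
    have h2 := h1.unique (hasDerivAt_Ad_const hx X s)
    simpa using h2
  have := hA.clm_apply hS
  rwa [hval] at this

lemma hasDerivAt_form (B : LinearMap.BilinForm ℝ E) {f h : ℝ → E} {f' h' : E} {s : ℝ}
    (hf : HasDerivAt f f' s) (hh : HasDerivAt h h' s) :
    HasDerivAt (fun s => B (f s) (h s)) (B f' (h s) + B (f s) h') s := by
  exact (((LinearMap.toContinuousBilinearMap B).hasFDerivAt (x := f s)).comp_hasDerivAt s hf).clm_apply hh

/-- Invariance of the form under `ad` integrates to invariance under `Ad`. -/
lemma IsInvariantForm.Ad_Ad {B : LinearMap.BilinForm ℝ E} (hB : IsInvariantForm G B)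
    [ConnectedSpace G] (x : G) (X Y : E) : B (Ad x X) (Ad x Y) = B X Y := by
  have := topologicalGroup_of_lieGroup 𝓘(ℝ, E) ∞ (G := G)
  let H : Subgroup G :=
    { carrier := {x | ∀ X Y, B (Ad x X) (Ad x Y) = B X Y}
      mul_mem' := by
        intro a b ha hb X Y
        simp only [mem_ofPred_eq] at ha hb
        rw [Ad_mul, Ad_mul, ha, hb]
      one_mem' := by intro X Y; simp
      inv_mem' := by
        intro a ha X Y
        simp only [mem_ofPred_eq] at ha
        rw [← ha]; simp }
  -- Along a path from 1, the derivative of the pairing cancels by ad-invariance. A subgroup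
  -- containing a neighbourhood of 1 is clopen, hence all of the connected group.
  have hnhds : (H : Set G) ∈ 𝓝 (1 : G) := by
    filter_upwards [eventually_exists_path (E := E) (G := G)]
    rintro y ⟨c, hc, hc0, rfl⟩ X Y
    have hd : ∀ s, HasDerivAt (fun s => B (Ad (c s) X) (Ad (c s) Y)) 0 s := by
      intro s
      have := hasDerivAt_form B (hasDerivAt_Ad_const hc X s) (hasDerivAt_Ad_const hc Y s)
      rwa [hB.adCLM_left, neg_add_cancel] at this
    have := is_const_of_deriv_eq_zero (fun s => (hd s).differentiableAt) (fun s => (hd s).deriv) 1 0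
    simpa [hc0] using this
  have hopen := H.isOpen_of_mem_nhds hnhds
  have huniv : (H : Set G) = univ := IsClopen.eq_univ ⟨H.isClosed_of_isOpen hopen, hopen⟩ ⟨1, H.one_mem⟩
  have hx : x ∈ (H : Set G) := huniv ▸ mem_univ x
  exact hx X Y

lemma IsInvariantForm.Ad_inv_left {B : LinearMap.BilinForm ℝ E} (hB : IsInvariantForm G B)
    [ConnectedSpace G] (x : G) (X Y : E) : B (Ad x⁻¹ X) Y = B X (Ad x Y) := by
  rw [← hB.Ad_Ad x]; simp

end Adjoint

end RealBranch

end

noncomputable section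

namespace RealBranch

open Filter Topology Set

/-! ### The subalgebra 𝔤_R and the adjoint action of G_R -/

section SplitRMatrix

variable {E : Type*} [NormedAddCommGroup E] [NormedSpace ℝ E]
  {G : Type*} [TopologicalSpace G] [ChartedSpace E G] [Group G]
  {V : Type*} [NormedAddCommGroup V] [NormedSpace ℝ V]
  {B : LinearMap.BilinForm ℝ E} {R : E →ₗ[ℝ] E}

lemma Rplus_apply (X : E) : Rplus R X = R X + X := rfl

lemma Rminus_apply (X : E) : Rminus R X = R X - X := rfl

lemma IsSplitRMatrix.Rplus_left (hR : IsSplitRMatrix G B R) (X Y : E) :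
    B (Rplus R X) Y = - B X (Rminus R Y) := by
  simp only [Rplus_apply, Rminus_apply, map_add, map_sub, LinearMap.add_apply, hR.skew]
  ring

lemma IsSplitRMatrix.Rminus_left (hR : IsSplitRMatrix G B R) (X Y : E) :
    B (Rminus R X) Y = - B X (Rplus R Y) := by
  simp only [Rplus_apply, Rminus_apply, map_add, map_sub, LinearMap.sub_apply, hR.skew]
  ring

lemma IsOneParam.map_zero {γ : ℝ → G} (hγ : IsOneParam (E := E) γ) : γ 0 = 1 := by
  have := hγ.2 0 0
  simpa using this

variable [LieGroup 𝓘(ℝ, E) ∞ G]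

lemma IsSplitRMatrix.adCLM_R (hR : IsSplitRMatrix G B R) (X Y : E) :
    adCLM G (R X) (R Y) = R (adCLM G (R X) Y + adCLM G X (R Y)) - adCLM G X Y := by
  have := hR.mcybe X Y
  simp only [lieBr_eq_adCLM] at this
  rw [sub_eq_iff_eq_add] at this
  rw [this]; abel

/-- The Yang-Baxter equation in the form used throughout: R⁺ and R⁻ are homomorphisms for the same
bracket [RX, Y] + [X, RY], so 𝔤_R is a subalgebra. -/
lemma IsSplitRMatrix.adCLM_Rplus (hR : IsSplitRMatrix G B R) (X Y : E) :
    adCLM G (Rplus R X) (Rplus R Y) = Rplus R (adCLM G (R X) Y + adCLM G X (R Y)) := by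
  simp only [Rplus_apply, map_add, add_apply, hR.adCLM_R]
  abel

lemma IsSplitRMatrix.adCLM_Rminus (hR : IsSplitRMatrix G B R) (X Y : E) :
    adCLM G (Rminus R X) (Rminus R Y) = Rminus R (adCLM G (R X) Y + adCLM G X (R Y)) := by
  simp only [Rminus_apply, map_add, map_sub, sub_apply, hR.adCLM_R]
  abel

lemma IsOneParam.rightLog_eq {γ : ℝ → G} (hγ : IsOneParam (E := E) γ) (s : ℝ) :
    (rightLog γ s 1 : E) = leftLog γ 0 1 := by
  have h1 : γ = fun r => γ (r - s) * γ s := by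
    ext r; rw [← hγ.2]; simp
  have hsub : ContDiff ℝ ∞ (fun r : ℝ => r - s) := contDiff_id.sub contDiff_const
  have h2 := rightLog_mul (u := fun r => γ (r - s)) (w := fun _ => γ s)
    (hγ.1.comp hsub.contMDiff) contMDiff_const s 1
  rw [rightLog_const, _root_.map_zero, add_zero, rightLog_comp hγ.1 hsub, ← h1] at h2
  rw [h2, leftLog_eq_Ad_rightLog hγ.1, hγ.map_zero]
  simp [fderiv_sub_const]

/-- A linear subspace `{(P₁ X, P₂ X)}` is preserved by a one-parameter group of adjoint actions
whose generator acts through `L`. -/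
lemma IsOneParam.Ad_inv_exp {γ : ℝ → G} [FiniteDimensional ℝ E] (hγ : IsOneParam (E := E) γ)
    (P : E →ₗ[ℝ] E) (L : E →L[ℝ] E)
    (hP : ∀ Y, adCLM G (leftLog γ 0 1 : E) (P Y) = P (L Y)) (U : E) (s : ℝ) :
    Ad (γ s)⁻¹ (P U) = P (NormedSpace.exp (s • (-L)) U) := by
  have : CompleteSpace E := FiniteDimensional.complete ℝ E
  let P' : E →L[ℝ] E := LinearMap.toContinuousLinearMap P
  have hd : ∀ r, HasDerivAt (fun r => Ad (γ r) (P' (NormedSpace.exp (r • (-L)) U))) 0 r := by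
    intro r
    have h1 := (hasDerivAt_exp_smul_const' (𝕂 := ℝ) (-L) r).clm_apply (hasDerivAt_const r U)
    have h2 := hasDerivAt_Ad hγ.1 ((P'.hasFDerivAt (x := NormedSpace.exp (r • (-L)) U)).comp_hasDerivAt r h1)
    convert! h2 using 1
    rw [hγ.rightLog_eq]
    -- Ad of a one-parameter group commutes with ad of its generator: differentiate Ad(γ(s)) =
    -- Ad(γ(r))Ad(γ(s − r)) at s = r in both ways.
    have h3 : ∀ Z : E, (adCLM G (leftLog γ 0 1 : E)) (Ad (γ r) Z) =
        Ad (γ r) (adCLM G (leftLog γ 0 1 : E) Z) := by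
      intro Z
      have hZ1 := hasDerivAt_Ad_const hγ.1 Z r
      have hZ2 : HasDerivAt (fun s => Ad (γ r) (Ad (γ (s - r)) Z))
          (Ad (γ r) (adCLM G (leftLog γ 0 1 : E) Z)) r := by
        have h4 := hasDerivAt_Ad_const hγ.1 Z (r - r)
        rw [hγ.rightLog_eq, sub_self, hγ.map_zero] at h4
        have h5 := (Ad (γ r)).hasFDerivAt.comp_hasDerivAt r
          (HasDerivAt.comp_sub_const r r (by simpa using h4))
        simpa [Function.comp_def] using h5
      have : (fun s => Ad (γ r) (Ad (γ (s - r)) Z)) = fun s => Ad (γ s) Z := by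
        ext s
        rw [← Ad_mul, ← hγ.2]; simp
      rw [this] at hZ2
      rw [← hγ.rightLog_eq r] at hZ2 ⊢
      exact hZ1.unique hZ2
    rw [h3]
    have h6 : P' (NormedSpace.exp (r • (-L)) U) = P (NormedSpace.exp (r • (-L)) U) := rfl
    simp only [Function.comp_def]
    rw [h6, hP]
    simp [P']
  have h := is_const_of_deriv_eq_zero (fun r => (hd r).differentiableAt)
    (fun r => (hd r).deriv) s 0
  simp only [hγ.map_zero, zero_smul, NormedSpace.exp_zero, Ad_one] at h
  have h7 : Ad (γ s) (P (NormedSpace.exp (s • (-L)) U)) = P U := by simpa [P'] using h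
  rw [← h7, Ad_inv_Ad]

variable [FiniteDimensional ℝ E]

/-- The adjoint action of `G_R` preserves `𝔤_R`. -/
lemma IsSplitRMatrix.exists_Ad (hR : IsSplitRMatrix G B R) {d : G × G} (hd : d ∈ GR G R) (U : E) :
    ∃ U' : E, Ad d.1 (Rplus R U) = Rplus R U' ∧ Ad d.2 (Rminus R U) = Rminus R U' := by
  -- The inverse is carried along because the induction over the generated subgroup has an inversion
  -- step. The same U' must serve both components, which the common L for R⁺ and R⁻ provides.
  suffices h : (∀ U : E, ∃ U' : E, Ad d.1 (Rplus R U) = Rplus R U' ∧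
      Ad d.2 (Rminus R U) = Rminus R U') ∧ (∀ U : E, ∃ U' : E, Ad d.1⁻¹ (Rplus R U) = Rplus R U' ∧
      Ad d.2⁻¹ (Rminus R U) = Rminus R U') from h.1 U
  clear U
  unfold GR at hd
  induction hd using Subgroup.closure_induction with
  | mem d hd =>
    obtain ⟨X, γp, γm, hp, hm, hpX, hmX, rfl⟩ := hd
    let L : E →L[ℝ] E := adCLM G (R X) + adCLM G X ∘L LinearMap.toContinuousLinearMap R
    have h1 := hp.Ad_inv_exp (Rplus R) L (fun Y => by rw [hpX, hR.adCLM_Rplus]; simp [L])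
    have h2 := hm.Ad_inv_exp (Rminus R) L (fun Y => by rw [hmX, hR.adCLM_Rminus]; simp [L])
    have inv : ∀ {γ : ℝ → G}, IsOneParam (E := E) γ → (γ (-1))⁻¹ = γ 1 := by
      intro γ hγ
      rw [inv_eq_iff_mul_eq_one, ← hγ.2]
      simpa using hγ.map_zero
    refine ⟨fun U => ⟨NormedSpace.exp ((-1 : ℝ) • (-L)) U, ?_, ?_⟩,
      fun U => ⟨_, h1 U 1, h2 U 1⟩⟩
    · rw [← h1, inv hp]
    · rw [← h2, inv hm]
  | one => exact ⟨fun U => ⟨U, by simp⟩, fun U => ⟨U, by simp⟩⟩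
  | mul a b _ _ ha hb =>
    refine ⟨fun U => ?_, fun U => ?_⟩
    · obtain ⟨U₁, h1, h2⟩ := hb.1 U
      obtain ⟨U₂, h3, h4⟩ := ha.1 U₁
      exact ⟨U₂, by simp [Ad_mul, h1, h3], by simp [Ad_mul, h2, h4]⟩
    · obtain ⟨U₁, h1, h2⟩ := ha.2 U
      obtain ⟨U₂, h3, h4⟩ := hb.2 U₁
      exact ⟨U₂, by simp [Ad_mul, h1, h3], by simp [Ad_mul, h2, h4]⟩
  | inv a _ ha => exact ⟨ha.2, by simpa using ha.1⟩

/-- The adjoint action of `G_R` on `𝔤_R`, identified with `𝔤` by `X ↦ (R⁺X, R⁻X)`. -/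
def AdR (R : E →ₗ[ℝ] E) (d : G × G) : E →L[ℝ] E :=
  (1 / 2 : ℝ) • (Ad d.1 ∘L LinearMap.toContinuousLinearMap (Rplus R) -
    Ad d.2 ∘L LinearMap.toContinuousLinearMap (Rminus R))

omit [LieGroup 𝓘(ℝ, E) ∞ G] in
lemma AdR_apply (d : G × G) (U : E) :
    AdR R d U = (1 / 2 : ℝ) • (Ad d.1 (Rplus R U) - Ad d.2 (Rminus R U)) := rfl

omit [LieGroup 𝓘(ℝ, E) ∞ G] [FiniteDimensional ℝ E] in
lemma Rplus_sub_Rminus (X : E) : (1 / 2 : ℝ) • (Rplus R X - Rminus R X) = X := by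
  rw [Rplus_apply, Rminus_apply]; module

lemma IsSplitRMatrix.Ad_Rplus (hR : IsSplitRMatrix G B R) {d : G × G} (hd : d ∈ GR G R) (U : E) :
    Ad d.1 (Rplus R U) = Rplus R (AdR R d U) := by
  obtain ⟨U', h1, h2⟩ := hR.exists_Ad hd U
  rw [AdR_apply, h1, h2, Rplus_sub_Rminus]

lemma IsSplitRMatrix.Ad_Rminus (hR : IsSplitRMatrix G B R) {d : G × G} (hd : d ∈ GR G R) (U : E) :
    Ad d.2 (Rminus R U) = Rminus R (AdR R d U) := by
  obtain ⟨U', h1, h2⟩ := hR.exists_Ad hd U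
  rw [AdR_apply, h1, h2, Rplus_sub_Rminus]

lemma IsSplitRMatrix.AdR_inv_AdR (hR : IsSplitRMatrix G B R) {d : G × G} (hd : d ∈ GR G R) (U : E) :
    AdR R d⁻¹ (AdR R d U) = U := by
  rw [AdR_apply, ← hR.Ad_Rplus hd, ← hR.Ad_Rminus hd, Prod.fst_inv, Prod.snd_inv, Ad_inv_Ad,
    Ad_inv_Ad, Rplus_sub_Rminus]

/-- `∂x_± x_±⁻¹ = R^± W` for this field `W`. -/
def logGR (xp xm : V → G) (q v : V) : E := (1 / 2 : ℝ) • (rightLog xp q v - rightLog xm q v)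

omit [LieGroup 𝓘(ℝ, E) ∞ G] [FiniteDimensional ℝ E] in
lemma IsSmoothGR.rightLog_p {xp xm : V → G} (h : IsSmoothGR R xp xm) (q v : V) :
    rightLog xp q v = Rplus R (logGR xp xm q v) := by
  obtain ⟨Y, h1, h2⟩ := h.tangent q v
  rw [logGR, h1, h2, Rplus_sub_Rminus]

omit [LieGroup 𝓘(ℝ, E) ∞ G] [FiniteDimensional ℝ E] in
lemma IsSmoothGR.rightLog_m {xp xm : V → G} (h : IsSmoothGR R xp xm) (q v : V) :
    rightLog xm q v = Rminus R (logGR xp xm q v) := by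
  obtain ⟨Y, h1, h2⟩ := h.tangent q v
  rw [logGR, h1, h2, Rplus_sub_Rminus]

omit [FiniteDimensional ℝ E] in
lemma IsSmoothGR.contDiff_logGR {xp xm : V → G} (h : IsSmoothGR R xp xm) (v : V) :
    ContDiff ℝ ∞ (fun q => (logGR xp xm q v : E)) :=
  ((contDiff_rightLog h.smooth_p v).sub (contDiff_rightLog h.smooth_m v)).const_smul _

/-- After identifying 𝔤_R with 𝔤, the infinitesimal adjoint action is the bracket [RX, Y] + [X, RY].
-/
lemma IsSplitRMatrix.hasDerivAt_AdR (hR : IsSplitRMatrix G B R) {xp xm : ℝ → G}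
    (h : IsSmoothGR R xp xm) (U : E) (s : ℝ) :
    HasDerivAt (fun s => AdR R (xp s, xm s) U)
      (adCLM G (R (logGR xp xm s 1)) (AdR R (xp s, xm s) U) +
        adCLM G (logGR xp xm s 1) (R (AdR R (xp s, xm s) U))) s := by
  have h1 := ((hasDerivAt_Ad_const h.smooth_p (Rplus R U) s).sub
    (hasDerivAt_Ad_const h.smooth_m (Rminus R U) s)).const_smul (1 / 2 : ℝ)
  have e1 := hR.Ad_Rplus (h.mem s) U
  have e2 := hR.Ad_Rminus (h.mem s) U
  simp only at e1 e2
  rw [h.rightLog_p, h.rightLog_m, e1, e2, hR.adCLM_Rplus, hR.adCLM_Rminus, Rplus_sub_Rminus] at h1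
  exact h1

lemma contDiff_AdR {xp xm : ℝ → G} (hp : ContMDiff 𝓘(ℝ, ℝ) 𝓘(ℝ, E) ∞ xp)
    (hm : ContMDiff 𝓘(ℝ, ℝ) 𝓘(ℝ, E) ∞ xm) :
    ContDiff ℝ ∞ (fun s => (AdR R (xp s, xm s) : E →L[ℝ] E)) :=
  (((contDiff_Ad hp).clm_comp contDiff_const).sub
    ((contDiff_Ad hm).clm_comp contDiff_const)).const_smul _

end SplitRMatrix

/-! ### Test functions on the cut circle -/

section TestFunctions

variable {F : Type*} [NormedAddCommGroup F] [NormedSpace ℝ F]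
  {F' : Type*} [NormedAddCommGroup F'] [NormedSpace ℝ F'] {a : ℝ} {φ : ℝ → F}

lemma IsTest.of_eq_zero (hφ : IsTest a φ) {f : ℝ → F'} (hf : ContDiff ℝ ∞ f)
    (h : ∀ θ, θ ∉ tsupport φ → f θ = 0) : IsTest a f := by
  have hsub : tsupport f ⊆ tsupport φ := by
    refine closure_minimal (fun θ hθ => ?_) (isClosed_tsupport φ)
    by_contra hn
    exact hθ (h θ hn)
  exact ⟨hf, hφ.compact.of_isClosed_subset (isClosed_tsupport f) hsub, hsub.trans hφ.support⟩

lemma IsTest.eq_zero_of_notMem (hφ : IsTest a φ) {θ : ℝ} (hθ : θ ∉ Ioo a (a + 2 * Real.pi)) :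
    φ θ = 0 := image_eq_zero_of_notMem_tsupport fun h => hθ (hφ.support h)

lemma deriv_eq_zero_of_notMem_tsupport {θ : ℝ} (hθ : θ ∉ tsupport φ) : deriv φ θ = 0 :=
  image_eq_zero_of_notMem_tsupport fun h => hθ (tsupport_deriv_subset (𝕜 := ℝ) h)

lemma IsTest.contDiff_deriv (hφ : IsTest a φ) : ContDiff ℝ ∞ (deriv φ) :=
  ((contDiff_infty_iff_deriv).1 hφ.smooth).2

lemma IsTest.hasDerivAt (hφ : IsTest a φ) (θ : ℝ) : HasDerivAt φ (deriv φ θ) θ :=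
  (hφ.smooth.differentiable (by simp) θ).hasDerivAt

lemma IsTest.integrable (hφ : IsTest a φ) : MeasureTheory.Integrable φ :=
  hφ.smooth.continuous.integrable_of_hasCompactSupport hφ.compact

/-- The integral of the derivative of a test function vanishes. -/
lemma IsTest.integral_eq_zero [CompleteSpace F] (hφ : IsTest a φ) {f : ℝ → F}
    (hf : ∀ θ, HasDerivAt φ (f θ) θ) : ∫ θ, f θ = 0 := by
  have hfd : f = deriv φ := funext fun θ => (hf θ).deriv.symm
  have ht : IsTest a (deriv φ) := hφ.of_eq_zero hφ.contDiff_deriv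
    fun θ => deriv_eq_zero_of_notMem_tsupport
  rw [hfd]
  exact MeasureTheory.integral_eq_zero_of_hasDerivAt_of_integrable hφ.hasDerivAt ht.integrable
    hφ.integrable

end TestFunctions

end RealBranch

end

noncomputable section

namespace RealBranch

open Filter Topology Set

/-! ### Differentiation under the integral sign -/

section ParametricIntegral

/-- Differentiation under the integral sign for smooth integrands with compact support. -/
lemma hasDerivAt_integral_of_contDiff {F : ℝ × ℝ → ℝ} (hF : ContDiff ℝ ∞ F) {K : Set ℝ}
    (hK : IsCompact K) (h0 : ∀ t, ∀ θ, θ ∉ K → F (t, θ) = 0) :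
    HasDerivAt (fun t => ∫ θ, F (t, θ)) (∫ θ, fderiv ℝ F (0, θ) (1, 0)) 0 := by
  have hF' : Continuous fun p : ℝ × ℝ => fderiv ℝ F p (1, 0) :=
    (hF.continuous_fderiv (by simp)).clm_apply continuous_const
  have hline : ∀ t θ, HasDerivAt (fun t => F (t, θ)) (fderiv ℝ F (t, θ) (1, 0)) t := fun t θ =>
    HasFDerivAt.comp_hasDerivAt t (f := fun r : ℝ => (r, θ))
      (hF.differentiable (by simp) (t, θ)).hasFDerivAt
      ((hasDerivAt_id t).prodMk (hasDerivAt_const t θ))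
  have h0' : ∀ t, ∀ θ, θ ∉ K → fderiv ℝ F (t, θ) (1, 0) = 0 := by
    intro t θ hθ
    have h1 : (fun t => F (t, θ)) = fun _ => 0 := funext fun t => h0 t θ hθ
    have h2 := hline t θ
    rw [h1] at h2
    exact h2.unique (hasDerivAt_const t 0)
  -- Only t near 0 matters, so a bound on the compact set [−1, 1] × K dominates the derivative.
  obtain ⟨C, hC⟩ := ((isCompact_Icc (a := (-1 : ℝ)) (b := 1)).prod hK).exists_bound_of_continuousOn
    hF'.continuousOn
  have hsupp : ∀ t, HasCompactSupport fun θ => F (t, θ) := fun t =>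
    HasCompactSupport.intro hK fun θ hθ => h0 t θ hθ
  have hcont : ∀ t, Continuous fun θ => F (t, θ) := fun t => hF.continuous.comp (by fun_prop)
  refine (hasDerivAt_integral_of_dominated_loc_of_deriv_le (F := fun t θ => F (t, θ))
    (F' := fun t θ => fderiv ℝ F (t, θ) (1, 0)) (bound := K.indicator fun _ => C)
    (Icc_mem_nhds (by norm_num : (-1 : ℝ) < 0) (by norm_num : (0 : ℝ) < 1))
    (Eventually.of_forall fun t => (hcont t).aestronglyMeasurable)
    ((hcont 0).integrable_of_hasCompactSupport (hsupp 0))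
    (hF'.comp (by fun_prop : Continuous fun θ : ℝ => ((0 : ℝ), θ))).aestronglyMeasurable
    (Eventually.of_forall fun θ t ht => ?_) ?_
    (Eventually.of_forall fun θ t _ => hline t θ)).2
  · by_cases hθ : θ ∈ K
    · rw [indicator_of_mem hθ]
      exact hC (t, θ) ⟨ht, hθ⟩
    · rw [indicator_of_notMem hθ, h0' t θ hθ, norm_zero]
  · exact (MeasureTheory.integrable_indicator_iff hK.measurableSet).2
      (MeasureTheory.integrableOn_const hK.measure_lt_top.ne)

end ParametricIntegral

/-! ### Functional derivatives of the fields g and 𝒥 -/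

section Gradient

variable {E : Type*} [NormedAddCommGroup E] [NormedSpace ℝ E]
  {G : Type*} [TopologicalSpace G] [ChartedSpace E G] [Group G]
  {V : Type*} [NormedAddCommGroup V] [NormedSpace ℝ V]
  {B : LinearMap.BilinForm ℝ E} {R : E →ₗ[ℝ] E} [LieGroup 𝓘(ℝ, E) ∞ G]

lemma contMDiff_fun_comp_mul_left {f : G → ℝ} (hf : ContMDiff 𝓘(ℝ, E) 𝓘(ℝ, ℝ) ∞ f) (x : G) :
    ContMDiff 𝓘(ℝ, E) 𝓘(ℝ, ℝ) ∞ (fun y => f (x * y)) :=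
  hf.comp (contMDiff_const.mul contMDiff_id)

omit [Group G] [LieGroup 𝓘(ℝ, E) ∞ G] in
lemma contDiff_comp_of_contMDiff {f : G → ℝ} (hf : ContMDiff 𝓘(ℝ, E) 𝓘(ℝ, ℝ) ∞ f) {u : V → G}
    (hu : ContMDiff 𝓘(ℝ, V) 𝓘(ℝ, E) ∞ u) : ContDiff ℝ ∞ (fun q => f (u q)) :=
  (hf.comp hu).contDiff

/-- The chain rule for functions on `G` in terms of left logarithmic derivatives. -/
lemma fderiv_comp_eq_leftInvDeriv {f : G → ℝ} (hf : ContMDiff 𝓘(ℝ, E) 𝓘(ℝ, ℝ) ∞ f) {u : V → G}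
    (hu : ContMDiff 𝓘(ℝ, V) 𝓘(ℝ, E) ∞ u) (q v : V) :
    fderiv ℝ (fun s => f (u s)) q v = leftInvDeriv f (leftLog u q v : E) (u q) := by
  have hf' := contMDiff_fun_comp_mul_left hf (u q)
  have hh : ContMDiff 𝓘(ℝ, V) 𝓘(ℝ, E) ∞ (fun s => (u q)⁻¹ * u s) := contMDiff_const.mul hu
  have h1 := mfderiv_eq_fderiv_oneChartSymm (V := ℝ) (hf'.mdifferentiable (by simp) (1 : G))
    (leftLog u q v : E)
  unfold leftInvDeriv
  rw [h1, leftLog_eq_velocity hu]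
  have hd : DifferentiableAt ℝ (fun a : E => f (u q * oneChartSymm G a)) (oneCoord G) := by
    have : ContMDiffAt 𝓘(ℝ, E) 𝓘(ℝ, ℝ) ∞ (fun a : E => f (u q * oneChartSymm G a)) (oneCoord G) :=
      ContMDiffAt.comp (g := fun y => f (u q * y)) (I' := 𝓘(ℝ, E)) _ (hf' _)
        contMDiffAt_oneChartSymm
    exact (contMDiffAt_iff_contDiffAt.1 this).differentiableAt (by simp)
  have hd' : DifferentiableAt ℝ (fun a : E => f (u q * oneChartSymm G a))
      (oneChart ((u q)⁻¹ * u q) : E) := by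
    rw [inv_mul_cancel]; exact hd
  have hv := (contDiffAt_oneChart_comp (E := E) (q := q) (by simp) (hh q)).differentiableAt (by simp)
  have h2 := HasFDerivAt.comp q (f := fun s => (oneChart ((u q)⁻¹ * u s) : E)) hd'.hasFDerivAt
    hv.hasFDerivAt
  have ev : (fun s => f (u s)) =ᶠ[𝓝 q] (fun a : E => f (u q * oneChartSymm G a)) ∘
      fun s => (oneChart ((u q)⁻¹ * u s) : E) := by
    have e := (hh q).continuousAt.eventually
      (by simpa using eventually_oneChartSymm_oneChart (E := E) (G := G))
    filter_upwards [e] with s hs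
    simp [hs]
  rw [(h2.congr_of_eventuallyEq ev).fderiv]
  simp [velocity, oneCoord]

lemma leftInvDeriv_eq_rightLog {f : G → ℝ} (hf : ContMDiff 𝓘(ℝ, E) 𝓘(ℝ, ℝ) ∞ f) {c : ℝ → G}
    (hc : ContMDiff 𝓘(ℝ, ℝ) 𝓘(ℝ, E) ∞ c) (hc0 : c 0 = 1) (x : G) :
    leftInvDeriv f (rightLog c 0 1 : E) x = fderiv ℝ (fun s => f (x * c s)) 0 1 := by
  have hu : ContMDiff 𝓘(ℝ, ℝ) 𝓘(ℝ, E) ∞ (fun s => x * c s) := contMDiff_const.mul hc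
  rw [fderiv_comp_eq_leftInvDeriv hf hu, leftLog_mul contMDiff_const hc,
    leftLog_eq_Ad_rightLog contMDiff_const, rightLog_const]
  simp [hc0]

lemma contDiff_leftInvDeriv {f : G → ℝ} (hf : ContMDiff 𝓘(ℝ, E) 𝓘(ℝ, ℝ) ∞ f) {u : V → G}
    (hu : ContMDiff 𝓘(ℝ, V) 𝓘(ℝ, E) ∞ u) (X : E) :
    ContDiff ℝ ∞ (fun q => leftInvDeriv f X (u q)) := by
  obtain ⟨c, hc, hc0, rfl⟩ := exists_curve G X
  simp_rw [leftInvDeriv_eq_rightLog hf hc hc0]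
  have h : ContDiff ℝ ∞ (Function.uncurry fun (q : V) (s : ℝ) => f (u q * c s)) :=
    contDiff_comp_of_contMDiff hf (contMDiff_mul_curve hu hc)
  exact (ContDiff.fderiv (m := ∞) h contDiff_const (by simp)).clm_apply contDiff_const

/-- The differential of `f` at `x` on left-invariant vector fields. -/
def leftInvDual (f : G → ℝ) (x : G) : E →ₗ[ℝ] ℝ where
  toFun X := leftInvDeriv f X x
  map_add' X Y := map_add (mfderiv 𝓘(ℝ, E) 𝓘(ℝ, ℝ) (fun y => f (x * y)) (1 : G)) X Y
  map_smul' r X := map_smul (mfderiv 𝓘(ℝ, E) 𝓘(ℝ, ℝ) (fun y => f (x * y)) (1 : G)) r X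

/-- The variation of Ψ⁺ splits into ε = g⁻¹δg and R⁺Y, with the same Y as for Ψ⁻ because (x_+, x_-)
moves inside G_R. -/
lemma IsVariation.leftLog_psip {γ : ℝ → FactorisedField G R} {p : FactorisedField G R}
    (hγ : IsVariation γ p) (θ : ℝ) :
    (leftLog (fun t => (γ t).psip θ) 0 1 : E) = Ad (p.xp θ)⁻¹
      (leftLog (fun t => (γ t).g θ) 0 1 + Rplus R (logGR (fun q : ℝ × ℝ => (γ q.1).xp q.2)
        (fun q : ℝ × ℝ => (γ q.1).xm q.2) (0, θ) (1, 0))) := by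
  have hθ : ContDiff ℝ ∞ (fun t : ℝ => (t, θ)) := contDiff_id.prodMk contDiff_const
  simp only [FactorisedField.fact_p]
  rw [leftLog_mul (u := fun t => (γ t).g θ) (w := fun t => (γ t).xp θ)
    (hγ.smooth_g.comp hθ.contMDiff) (hγ.smooth_x.smooth_p.comp hθ.contMDiff),
    rightLog_comp (u := fun q : ℝ × ℝ => (γ q.1).xp q.2) hγ.smooth_x.smooth_p hθ,
    hγ.smooth_x.rightLog_p, hγ.start]
  congr 4
  rw [fderiv_apply_one_eq_deriv]
  exact ((hasDerivAt_id (0 : ℝ)).prodMk (hasDerivAt_const (0 : ℝ) θ)).deriv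

lemma IsVariation.leftLog_psim {γ : ℝ → FactorisedField G R} {p : FactorisedField G R}
    (hγ : IsVariation γ p) (θ : ℝ) :
    (leftLog (fun t => (γ t).psim θ) 0 1 : E) = Ad (p.xm θ)⁻¹
      (leftLog (fun t => (γ t).g θ) 0 1 + Rminus R (logGR (fun q : ℝ × ℝ => (γ q.1).xp q.2)
        (fun q : ℝ × ℝ => (γ q.1).xm q.2) (0, θ) (1, 0))) := by
  have hθ : ContDiff ℝ ∞ (fun t : ℝ => (t, θ)) := contDiff_id.prodMk contDiff_const
  simp only [FactorisedField.fact_m]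
  rw [leftLog_mul (u := fun t => (γ t).g θ) (w := fun t => (γ t).xm θ)
    (hγ.smooth_g.comp hθ.contMDiff) (hγ.smooth_x.smooth_m.comp hθ.contMDiff),
    rightLog_comp (u := fun q : ℝ × ℝ => (γ q.1).xm q.2) hγ.smooth_x.smooth_m hθ,
    hγ.smooth_x.rightLog_m, hγ.start]
  congr 4
  rw [fderiv_apply_one_eq_deriv]
  exact ((hasDerivAt_id (0 : ℝ)).prodMk (hasDerivAt_const (0 : ℝ) θ)).deriv

variable [FiniteDimensional ℝ E]

/-- The left gradient of `f` with respect to the form `B`. -/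
def leftGrad (B : LinearMap.BilinForm ℝ E) (hB : B.Nondegenerate) (f : G → ℝ) (x : G) : E :=
  (B.toDual hB).symm (leftInvDual f x)

omit [LieGroup 𝓘(ℝ, E) ∞ G] in
lemma form_leftGrad (hB : B.Nondegenerate) (f : G → ℝ) (x : G) (X : E) :
    B (leftGrad B hB f x) X = leftInvDeriv f X x := by
  have := B.apply_toDual_symm_apply (hB := hB) (leftInvDual f x) X
  exact this

lemma contDiff_leftGrad (hB : B.Nondegenerate) {f : G → ℝ} (hf : ContMDiff 𝓘(ℝ, E) 𝓘(ℝ, ℝ) ∞ f)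
    {u : V → G} (hu : ContMDiff 𝓘(ℝ, V) 𝓘(ℝ, E) ∞ u) :
    ContDiff ℝ ∞ (fun q => leftGrad B hB f (u q)) := by
  have h1 : ContDiff ℝ ∞ (fun q => LinearMap.toContinuousLinearMap (leftInvDual f (u q) : E →ₗ[ℝ] ℝ)) :=
    contDiff_clm_apply_iff.2 fun X => contDiff_leftInvDeriv hf hu X
  let T : (E →L[ℝ] ℝ) →ₗ[ℝ] E := (B.toDual hB).symm.toLinearMap ∘ₗ
    LinearMap.toContinuousLinearMap.symm.toLinearMap
  exact (LinearMap.toContinuousLinearMap T).contDiff.comp h1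

omit [LieGroup 𝓘(ℝ, E) ∞ G] in
lemma contDiff_form (B : LinearMap.BilinForm ℝ E) {f h : V → E} (hf : ContDiff ℝ ∞ f)
    (hh : ContDiff ℝ ∞ h) : ContDiff ℝ ∞ (fun q => B (f q) (h q)) :=
  ((LinearMap.toContinuousBilinearMap B).contDiff.comp hf).clm_apply hh

omit [LieGroup 𝓘(ℝ, E) ∞ G] in
lemma contDiff_linearMap (L : E →ₗ[ℝ] E) {f : V → E} (hf : ContDiff ℝ ∞ f) :
    ContDiff ℝ ∞ (fun q => L (f q)) :=
  (LinearMap.toContinuousLinearMap L).contDiff.comp hf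

omit [LieGroup 𝓘(ℝ, E) ∞ G] [FiniteDimensional ℝ E] in
lemma contDiff_adCLM {f h : V → E} (hf : ContDiff ℝ ∞ f) (hh : ContDiff ℝ ∞ h) :
    ContDiff ℝ ∞ (fun q => adCLM G (f q) (h q)) :=
  ((adCLM (E := E) G).contDiff.comp hf).clm_apply hh

lemma IsTest.Ad_inv {a : ℝ} {A : ℝ → E} (hA : IsTest a A) {x : ℝ → G}
    (hx : ContMDiff 𝓘(ℝ, ℝ) 𝓘(ℝ, E) ∞ x) : IsTest a (fun θ => Ad (x θ)⁻¹ (A θ)) :=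
  hA.of_eq_zero ((contDiff_Ad hx.inv).clm_apply hA.smooth) fun θ hθ => by
    rw [image_eq_zero_of_notMem_tsupport hθ, map_zero]

variable [ConnectedSpace G]

/-- The functional derivative of `∫ φ f(g)`. -/
lemma hasGradient_obsG (hB : IsInvariantForm G B) (hR : IsSplitRMatrix G B R) {f : G → ℝ}
    (hf : ContMDiff 𝓘(ℝ, E) 𝓘(ℝ, ℝ) ∞ f) {a : ℝ} {φ : ℝ → ℝ} (hφ : IsTest a φ)
    (p : FactorisedField G R) :
    HasGradient B a (obsG f φ)
      (fun θ => Ad (p.xp θ)⁻¹ ((φ θ / 2) • Rplus R (leftGrad B hB.nondegenerate f (p.g θ))))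
      (fun θ => Ad (p.xm θ)⁻¹ (-((φ θ / 2) • Rminus R (leftGrad B hB.nondegenerate f (p.g θ))))) p where
  test_p := by
    refine IsTest.Ad_inv (hφ.of_eq_zero ?_ fun θ hθ => ?_) p.smooth_x.smooth_p
    · exact (hφ.smooth.div_const _).smul (contDiff_linearMap _ (contDiff_leftGrad _ hf p.smooth_g))
    · simp [image_eq_zero_of_notMem_tsupport hθ]
  test_m := by
    refine IsTest.Ad_inv (hφ.of_eq_zero ?_ fun θ hθ => ?_) p.smooth_x.smooth_m
    · exact ((hφ.smooth.div_const _).smul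
        (contDiff_linearMap _ (contDiff_leftGrad _ hf p.smooth_g))).neg
    · simp [image_eq_zero_of_notMem_tsupport hθ]
  deriv γ hγ := by
    have hF : ContDiff ℝ ∞ (fun q : ℝ × ℝ => φ q.2 * f ((γ q.1).g q.2)) :=
      (hφ.smooth.comp contDiff_snd).mul (contDiff_comp_of_contMDiff hf hγ.smooth_g)
    have h := hasDerivAt_integral_of_contDiff hF hφ.compact.isCompact fun t θ hθ => by
      simp [image_eq_zero_of_notMem_tsupport hθ]
    unfold obsG
    convert! h using 1
    refine MeasureTheory.integral_congr_ae (Eventually.of_forall fun θ => ?_)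
    have hθ : ContDiff ℝ ∞ (fun t : ℝ => (t, θ)) := contDiff_id.prodMk contDiff_const
    have h1 := HasFDerivAt.comp_hasDerivAt (0 : ℝ) (f := fun r : ℝ => (r, θ))
      (hF.differentiable (by simp) (0, θ)).hasFDerivAt
      ((hasDerivAt_id (0 : ℝ)).prodMk (hasDerivAt_const (0 : ℝ) θ))
    have hu : ContMDiff 𝓘(ℝ, ℝ) 𝓘(ℝ, E) ∞ (fun t => (γ t).g θ) := hγ.smooth_g.comp hθ.contMDiff
    have h2 := ((contDiff_comp_of_contMDiff hf hu).differentiable (by simp) 0).hasDerivAt.const_mul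
      (φ θ)
    rw [← fderiv_apply_one_eq_deriv, fderiv_comp_eq_leftInvDeriv hf hu, hγ.start,
      ← form_leftGrad hB.nondegenerate] at h2
    have h3 := h1.unique h2
    simp only
    rw [hγ.leftLog_psip, hγ.leftLog_psim, hB.Ad_Ad, hB.Ad_Ad, h3]
    -- The Y-terms cancel since ⟨R⁺N, R⁺Y⟩ = ⟨R⁻N, R⁻Y⟩, and the ε-terms add up because R⁺ − R⁻ = 2.
    simp only [map_add, map_neg, map_smul, LinearMap.neg_apply, LinearMap.smul_apply, smul_eq_mul,
      hR.Rplus_left, hR.Rminus_left]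
    simp only [Rplus_apply, Rminus_apply, map_add, map_sub]
    ring

/-- `D^± φ = φ' - [R^± W, φ]` is the covariant derivative of `φ` for the current `R^± W`; this is
the combination of both which pairs with the variation of the current `𝒥`. -/
def currentGrad (G : Type*) [TopologicalSpace G] [ChartedSpace E G] [Group G]
    (R : E →ₗ[ℝ] E) (υp υm : ℝ) (W φ φ' : E) : E :=
  (1 / 2 : ℝ) • (υp⁻¹ • Rminus R (φ' - adCLM G (Rplus R W) φ) -
    υm⁻¹ • Rplus R (φ' - adCLM G (Rminus R W) φ))

omit [LieGroup 𝓘(ℝ, E) ∞ G] [ConnectedSpace G] in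
lemma contDiff_currentGrad (υp υm : ℝ) {W φ φ' : ℝ → E} (hW : ContDiff ℝ ∞ W) (hφ : ContDiff ℝ ∞ φ)
    (hφ' : ContDiff ℝ ∞ φ') : ContDiff ℝ ∞ fun θ => currentGrad G R υp υm (W θ) (φ θ) (φ' θ) := by
  have h : ∀ L : E →ₗ[ℝ] E, ContDiff ℝ ∞ fun θ => φ' θ - adCLM G (L (W θ)) (φ θ) := fun L =>
    hφ'.sub (contDiff_adCLM (contDiff_linearMap L hW) hφ)
  exact (((contDiff_linearMap _ (h _)).const_smul _).sub
    ((contDiff_linearMap _ (h _)).const_smul _)).const_smul _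

omit [ConnectedSpace G] in
lemma isTest_currentGrad (υp υm : ℝ) {a : ℝ} {φ : ℝ → E} (hφ : IsTest a φ)
    (p : FactorisedField G R) :
    IsTest a fun θ => currentGrad G R υp υm (logGR p.xp p.xm θ 1) (φ θ) (deriv φ θ) :=
  hφ.of_eq_zero (contDiff_currentGrad υp υm (p.smooth_x.contDiff_logGR 1) hφ.smooth
    hφ.contDiff_deriv) fun θ hθ => by
      simp [currentGrad, image_eq_zero_of_notMem_tsupport hθ, deriv_eq_zero_of_notMem_tsupport hθ]

/-- The functional derivative of `∫ ⟨φ, 𝒥⟩`. -/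
lemma hasGradient_obsJ (hB : IsInvariantForm G B) (hR : IsSplitRMatrix G B R) (υp υm : ℝ)
    {a : ℝ} {φ : ℝ → E} (hφ : IsTest a φ) (p : FactorisedField G R) :
    HasGradient B a (obsJ B υp υm φ)
      (fun θ => Ad (p.xp θ)⁻¹ ((1 / 2 : ℝ) •
        currentGrad G R υp υm (logGR p.xp p.xm θ 1) (φ θ) (deriv φ θ)))
      (fun θ => Ad (p.xm θ)⁻¹ (-((1 / 2 : ℝ) •
        currentGrad G R υp υm (logGR p.xp p.xm θ 1) (φ θ) (deriv φ θ)))) p where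
  test_p := by
    have h := isTest_currentGrad υp υm hφ p
    refine IsTest.Ad_inv (h.of_eq_zero (h.smooth.const_smul _) fun θ hθ => ?_) p.smooth_x.smooth_p
    simp [image_eq_zero_of_notMem_tsupport hθ]
  test_m := by
    have h := isTest_currentGrad υp υm hφ p
    refine IsTest.Ad_inv (h.of_eq_zero (h.smooth.const_smul _).neg fun θ hθ => ?_)
      p.smooth_x.smooth_m
    simp [image_eq_zero_of_notMem_tsupport hθ]
  deriv γ hγ := by
    set XP : ℝ × ℝ → G := fun q => (γ q.1).xp q.2 with hXP
    set XM : ℝ × ℝ → G := fun q => (γ q.1).xm q.2 with hXM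
    have hX : IsSmoothGR R XP XM := hγ.smooth_x
    have hcur : ∀ t θ, currentJ υp υm (γ t) θ = (1 / 2 : ℝ) • (υp⁻¹ • (rightLog XP (t, θ) (0, 1) : E)
        - υm⁻¹ • (rightLog XM (t, θ) (0, 1) : E)) := by
      intro t θ
      have ht : ContDiff ℝ ∞ (fun θ : ℝ => (t, θ)) := contDiff_const.prodMk contDiff_id
      have hv : fderiv ℝ (fun θ : ℝ => (t, θ)) θ 1 = (0, 1) := by
        rw [fderiv_apply_one_eq_deriv]
        exact ((hasDerivAt_const θ t).prodMk (hasDerivAt_id θ)).deriv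
      have h1 := rightLog_comp (u := XP) (E := E) hX.smooth_p ht θ 1
      have h2 := rightLog_comp (u := XM) (E := E) hX.smooth_m ht θ 1
      rw [hv] at h1 h2
      rw [← h1, ← h2]
      rfl
    have hJs : ContDiff ℝ ∞ (fun q : ℝ × ℝ => (1 / 2 : ℝ) • (υp⁻¹ • (rightLog XP q (0, 1) : E)
        - υm⁻¹ • (rightLog XM q (0, 1) : E))) :=
      (((contDiff_rightLog hX.smooth_p _).const_smul _).sub
        ((contDiff_rightLog hX.smooth_m _).const_smul _)).const_smul _
    have hF : ContDiff ℝ ∞ (fun q : ℝ × ℝ => B (φ q.2) ((1 / 2 : ℝ) •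
        (υp⁻¹ • (rightLog XP q (0, 1) : E) - υm⁻¹ • (rightLog XM q (0, 1) : E)))) :=
      contDiff_form B (hφ.smooth.comp contDiff_snd) hJs
    have h := hasDerivAt_integral_of_contDiff hF hφ.compact.isCompact fun t θ hθ => by
      simp [image_eq_zero_of_notMem_tsupport hθ]
    unfold obsJ
    simp only [hcur]
    convert! h using 1
    -- the variation of the fields and of the current
    set Y : ℝ → E := fun θ => logGR XP XM (0, θ) (1, 0) with hY
    have hYs : ContDiff ℝ ∞ Y := (hX.contDiff_logGR (1, 0)).comp
      (contDiff_const.prodMk contDiff_id : ContDiff ℝ ∞ fun θ : ℝ => ((0 : ℝ), θ))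
    set Wt : ℝ → E := fun θ => logGR p.xp p.xm θ 1 with hWt
    have hWX : ∀ θ, logGR XP XM (0, θ) (0, 1) = Wt θ := by
      intro θ
      have ht : ContDiff ℝ ∞ (fun θ : ℝ => ((0 : ℝ), θ)) := contDiff_const.prodMk contDiff_id
      have hv : fderiv ℝ (fun θ : ℝ => ((0 : ℝ), θ)) θ 1 = (0, 1) := by
        rw [fderiv_apply_one_eq_deriv]
        exact ((hasDerivAt_const θ (0 : ℝ)).prodMk (hasDerivAt_id θ)).deriv
      have h1 := rightLog_comp (u := XP) (E := E) hX.smooth_p ht θ 1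
      have h2 := rightLog_comp (u := XM) (E := E) hX.smooth_m ht θ 1
      rw [hv] at h1 h2
      simp only [hWt, logGR]
      rw [← h1, ← h2]
      simp only [hXP, hXM, hγ.start]
    have hYd : ∀ θ, HasDerivAt Y (deriv Y θ) θ := fun θ =>
      (hYs.differentiable (by simp) θ).hasDerivAt
    -- Maurer-Cartan in the (t, θ)-plane exchanges the derivatives: δ(∂x x⁻¹) is the θ-derivative of
    -- δx x⁻¹ plus a commutator. The map L stands for R⁺ or R⁻.
    have hmc : ∀ (L : E →ₗ[ℝ] E) (X : ℝ × ℝ → G), ContMDiff 𝓘(ℝ, ℝ × ℝ) 𝓘(ℝ, E) ∞ X →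
        (∀ q v, rightLog X q v = L (logGR XP XM q v)) → ∀ θ,
        fderiv ℝ (fun q => (rightLog X q (0, 1) : E)) (0, θ) (1, 0) =
          L (deriv Y θ) + adCLM G (L (Y θ)) (L (Wt θ)) := by
      intro L X hXs hL θ
      have mc := maurerCartan (E := E) hXs (0, θ) (1, 0) (0, 1)
      rw [sub_eq_iff_eq_add, lieBr_eq_adCLM, hL, hL, hWX] at mc
      rw [mc, add_comm]
      congr 1
      have h1 := HasFDerivAt.comp_hasDerivAt θ (f := fun r : ℝ => ((0 : ℝ), r))
        ((contDiff_rightLog hXs (1, 0)).differentiable (by simp) (0, θ)).hasFDerivAt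
        ((hasDerivAt_const θ (0 : ℝ)).prodMk (hasDerivAt_id θ))
      have h2 := (LinearMap.toContinuousLinearMap L).hasFDerivAt.comp_hasDerivAt θ (hYd θ)
      have h3 : ((fun s : ℝ × ℝ => (rightLog X s (1, 0) : E)) ∘ fun r : ℝ => ((0 : ℝ), r)) =
          (LinearMap.toContinuousLinearMap L) ∘ Y := by
        ext r; simp [hL, hY]
      rw [h3] at h1
      exact h1.unique h2
    have hD : ∀ θ, fderiv ℝ (fun q : ℝ × ℝ => B (φ q.2) ((1 / 2 : ℝ) •
        (υp⁻¹ • (rightLog XP q (0, 1) : E) - υm⁻¹ • (rightLog XM q (0, 1) : E)))) (0, θ) (1, 0) =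
        B (φ θ) ((1 / 2 : ℝ) • (υp⁻¹ • (Rplus R (deriv Y θ) + adCLM G (Rplus R (Y θ)) (Rplus R (Wt θ)))
          - υm⁻¹ • (Rminus R (deriv Y θ) + adCLM G (Rminus R (Y θ)) (Rminus R (Wt θ))))) := by
      intro θ
      have hline : HasDerivAt (fun r : ℝ => (r, θ)) (1, 0) 0 :=
        (hasDerivAt_id (0 : ℝ)).prodMk (hasDerivAt_const (0 : ℝ) θ)
      have h0 := HasFDerivAt.comp_hasDerivAt (0 : ℝ) (f := fun r : ℝ => (r, θ))
        (hF.differentiable (by simp) (0, θ)).hasFDerivAt hline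
      have h1 := HasFDerivAt.comp_hasDerivAt (0 : ℝ) (f := fun r : ℝ => (r, θ))
        ((contDiff_rightLog (E := E) hX.smooth_p (0, 1)).differentiable (by simp) (0, θ)).hasFDerivAt hline
      have h2 := HasFDerivAt.comp_hasDerivAt (0 : ℝ) (f := fun r : ℝ => (r, θ))
        ((contDiff_rightLog (E := E) hX.smooth_m (0, 1)).differentiable (by simp) (0, θ)).hasFDerivAt hline
      rw [hmc _ _ hX.smooth_p hX.rightLog_p] at h1
      rw [hmc _ _ hX.smooth_m hX.rightLog_m] at h2
      have h3 := hasDerivAt_form B (hasDerivAt_const (0 : ℝ) (φ θ))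
        (((h1.const_smul υp⁻¹).sub (h2.const_smul υm⁻¹)).const_smul (1 / 2 : ℝ))
      have h4 := h0.unique h3
      rw [h4]
      simp
    -- The opposite signs of the two components make ε drop out: 𝒥 depends on x_± only.
    have hrhs : ∀ M ε Z : E, B ((1 / 2 : ℝ) • M) (ε + Rplus R Z) +
        B (-((1 / 2 : ℝ) • M)) (ε + Rminus R Z) = B M Z := by
      intro M ε Z
      simp only [Rplus_apply, Rminus_apply, map_add, map_sub, map_neg, map_smul,
        LinearMap.neg_apply, LinearMap.smul_apply, smul_eq_mul]
      ring
    simp only [hD, hγ.leftLog_psip, hγ.leftLog_psim, hB.Ad_Ad, hrhs]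
    rw [← sub_eq_zero, ← MeasureTheory.integral_sub]
    · have ht : IsTest a fun θ => -((1 / 2 : ℝ) * (υp⁻¹ * B (φ θ) (Rplus R (Y θ))
          - υm⁻¹ * B (φ θ) (Rminus R (Y θ)))) :=
        hφ.of_eq_zero (contDiff_const.mul
          ((contDiff_const.mul (contDiff_form B hφ.smooth (contDiff_linearMap _ hYs))).sub
          (contDiff_const.mul (contDiff_form B hφ.smooth (contDiff_linearMap _ hYs))))).neg
          fun θ hθ => by simp [image_eq_zero_of_notMem_tsupport hθ]
      refine ht.integral_eq_zero fun θ => ?_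
      have hL : ∀ L : E →ₗ[ℝ] E, HasDerivAt (fun θ => B (φ θ) (L (Y θ)))
          (B (deriv φ θ) (L (Y θ)) + B (φ θ) (L (deriv Y θ))) θ := fun L =>
        hasDerivAt_form B (hφ.hasDerivAt θ)
          ((LinearMap.toContinuousLinearMap L).hasFDerivAt.comp_hasDerivAt θ (hYd θ))
      have h5 := ((((hL (Rplus R)).const_mul υp⁻¹).sub
        ((hL (Rminus R)).const_mul υm⁻¹)).const_mul (1 / 2 : ℝ)).neg
      convert! h5 using 1
      simp only [currentGrad]
      have e1 : ∀ P Q : E, B (φ θ) (adCLM G P Q) = B (adCLM G Q (φ θ)) P := by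
        intro P Q
        rw [adCLM_swap P Q, hB.adCLM_left, map_neg]
      simp only [e1, map_add, map_sub, map_smul, LinearMap.sub_apply,
        LinearMap.smul_apply, smul_eq_mul, hR.Rplus_left, hR.Rminus_left]
      simp only [Rplus_apply, Rminus_apply, map_add, map_sub, add_apply,
        sub_apply, LinearMap.add_apply, LinearMap.sub_apply]
      ring
    · have h6 := isTest_currentGrad υp υm hφ p
      exact (h6.of_eq_zero (contDiff_form B h6.smooth hYs) fun θ hθ => by
        simp [image_eq_zero_of_notMem_tsupport hθ]).integrable
    · have hYs' : ContDiff ℝ ∞ (deriv Y) := (contDiff_infty_iff_deriv.1 hYs).2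
      have hWs : ContDiff ℝ ∞ Wt := p.smooth_x.contDiff_logGR 1
      have h6 : ∀ L : E →ₗ[ℝ] E, ContDiff ℝ ∞ fun θ =>
          L (deriv Y θ) + adCLM G (L (Y θ)) (L (Wt θ)) := fun L =>
        (contDiff_linearMap L hYs').add
          (contDiff_adCLM (contDiff_linearMap L hYs) (contDiff_linearMap L hWs))
      exact (hφ.of_eq_zero (contDiff_form B hφ.smooth ((((h6 _).const_smul υp⁻¹).sub
        ((h6 _).const_smul υm⁻¹)).const_smul (1 / 2 : ℝ))) fun θ hθ => by
          simp [image_eq_zero_of_notMem_tsupport hθ]).integrable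

end Gradient

end RealBranch

end

noncomputable section

namespace RealBranch

open Filter Topology Set

/-! ### The exchange kernel on one fundamental domain -/

section ExchangeKernel

variable {E : Type*} [NormedAddCommGroup E] [NormedSpace ℝ E]

lemma stair_eq_zero {θ θ' : ℝ} (h : θ' ≤ θ) (h' : θ < θ' + 2 * Real.pi) : stair θ θ' = 0 := by
  have hpi := Real.two_pi_pos
  have : ⌊(θ - θ') / (2 * Real.pi)⌋ = 0 := by
    rw [Int.floor_eq_zero_iff]
    exact ⟨div_nonneg (by linarith) hpi.le, (div_lt_one hpi).2 (by linarith)⟩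
  simp [stair, this]

lemma stair_eq_neg_one {θ θ' : ℝ} (h : θ < θ') (h' : θ' ≤ θ + 2 * Real.pi) : stair θ θ' = -1 := by
  have hpi := Real.two_pi_pos
  have : ⌊(θ - θ') / (2 * Real.pi)⌋ = -1 := by
    rw [Int.floor_eq_iff]
    constructor
    · rw [le_div_iff₀ hpi]; push_cast; linarith
    · rw [div_lt_iff₀ hpi]; push_cast; linarith
  simp [stair, this]

variable {B : LinearMap.BilinForm ℝ E} {R : E →ₗ[ℝ] E} {a : ℝ}

lemma exchangeKernel_of_lt {θ θ' : ℝ} (hθ : θ ∈ Ioo a (a + 2 * Real.pi))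
    (hθ' : θ' ∈ Ioo a (a + 2 * Real.pi)) (h : θ < θ') (X Y : E) :
    exchangeKernel B R θ θ' X Y = - B X (Rplus R Y) := by
  rw [exchangeKernel, stair_eq_neg_one h (by linarith [hθ.1, hθ'.2]),
    stair_eq_zero h.le (by linarith [hθ.1, hθ'.2])]
  ring

lemma exchangeKernel_of_gt {θ θ' : ℝ} (hθ : θ ∈ Ioo a (a + 2 * Real.pi))
    (hθ' : θ' ∈ Ioo a (a + 2 * Real.pi)) (h : θ' < θ) (X Y : E) :
    exchangeKernel B R θ θ' X Y = - B X (Rminus R Y) := by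
  rw [exchangeKernel, stair_eq_neg_one h (by linarith [hθ'.1, hθ.2]),
    stair_eq_zero h.le (by linarith [hθ'.1, hθ.2])]
  ring

lemma IsTest.primitive_of_le {A : ℝ → E} (hA : IsTest a A) {θ : ℝ} (h : θ ≤ a) :
    ∫ s in a..θ, A s = 0 := by
  rw [intervalIntegral.integral_symm, intervalIntegral.integral_of_le h,
    MeasureTheory.setIntegral_eq_zero_of_forall_eq_zero, neg_zero]
  exact fun s hs => hA.eq_zero_of_notMem fun h' => absurd h'.1 (not_lt.2 hs.2)

lemma IsTest.primitive_of_ge {A : ℝ → E} (hA : IsTest a A) {θ : ℝ} (h : a + 2 * Real.pi ≤ θ) :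
    ∫ s in a..θ, A s = ∫ s, A s := by
  have hpi := Real.two_pi_pos
  rw [intervalIntegral.integral_of_le (by linarith),
    MeasureTheory.setIntegral_eq_integral_of_forall_compl_eq_zero]
  exact fun s hs => hA.eq_zero_of_notMem fun h' => hs ⟨h'.1, h'.2.le.trans h⟩

lemma IsTest.setIntegral_Iic {A : ℝ → E} (hA : IsTest a A) (θ : ℝ) :
    ∫ s in Iic θ, A s = ∫ s in a..θ, A s := by
  rw [← intervalIntegral.integral_Iic_sub_Iic hA.integrable.integrableOn hA.integrable.integrableOn,
    MeasureTheory.setIntegral_eq_zero_of_forall_eq_zero (t := Iic a), sub_zero]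
  exact fun s hs => hA.eq_zero_of_notMem fun h' => absurd h'.1 (not_lt.2 hs)

lemma integral_eq_intervalIntegral_of_eq_zero {f : ℝ → ℝ}
    (hf : ∀ θ, θ ∉ Ioo a (a + 2 * Real.pi) → f θ = 0) :
    ∫ θ, f θ = ∫ θ in a..(a + 2 * Real.pi), f θ := by
  have hpi := Real.two_pi_pos
  rw [intervalIntegral.integral_of_le (by linarith),
    MeasureTheory.setIntegral_eq_integral_of_forall_compl_eq_zero]
  exact fun s hs => hf s fun h' => hs ⟨h'.1, h'.2.le⟩

/-- Integrating the first slot of the exchange kernel against `A`. -/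
def exchangePotential (R : E →ₗ[ℝ] E) (a : ℝ) (A : ℝ → E) (θ : ℝ) : E :=
  Rplus R (∫ s, A s) - (2 : ℝ) • ∫ s in a..θ, A s

variable [FiniteDimensional ℝ E]

lemma IsTest.hasDerivAt_primitive {A : ℝ → E} (hA : IsTest a A) (θ : ℝ) :
    HasDerivAt (fun θ => ∫ s in a..θ, A s) (A θ) θ :=
  have := FiniteDimensional.complete ℝ E
  (hA.smooth.continuous.integral_hasStrictDerivAt a θ).hasDerivAt

lemma IsTest.hasDerivAt_exchangePotential {A : ℝ → E} (hA : IsTest a A) (θ : ℝ) :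
    HasDerivAt (exchangePotential R a A) (-((2 : ℝ) • A θ)) θ :=
  ((hA.hasDerivAt_primitive θ).const_smul (2 : ℝ)).const_sub _

lemma IsTest.integral_form {C : ℝ → E} (hC : IsTest a C) (X : E) :
    ∫ θ, B X (C θ) = B X (∫ θ, C θ) :=
  have := FiniteDimensional.complete ℝ E
  (LinearMap.toContinuousBilinearMap B X).integral_comp_comm hC.integrable

lemma IsTest.integrable_form {C S : ℝ → E} (hC : IsTest a C) (hS : Continuous S) :
    MeasureTheory.Integrable fun θ => B (S θ) (C θ) := by
  have h1 : Continuous fun θ => B (S θ) (C θ) :=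
    ((LinearMap.toContinuousBilinearMap B).continuous.comp hS).clm_apply hC.smooth.continuous
  refine h1.integrable_of_hasCompactSupport (hC.compact.mono fun θ hθ => ?_)
  contrapose! hθ
  simp [Function.notMem_support.1 hθ]

lemma IsTest.integrable_form' {A S : ℝ → E} (hA : IsTest a A) (hS : Continuous S) :
    MeasureTheory.Integrable fun θ => B (A θ) (S θ) :=
  hA.integrable_form (B := B.flip) hS

lemma IsTest.continuous_primitive {A : ℝ → E} (hA : IsTest a A) :
    Continuous fun θ => ∫ s in a..θ, A s :=
  continuous_iff_continuousAt.2 fun θ => (hA.hasDerivAt_primitive θ).continuousAt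

/-- Integration by parts for primitives of test functions. -/
lemma IsTest.integral_form_primitive {A C : ℝ → E} (hA : IsTest a A) (hC : IsTest a C) :
    ∫ θ, B (A θ) (∫ s in a..θ, C s) =
      B (∫ θ, A θ) (∫ θ, C θ) - ∫ θ, B (∫ s in a..θ, A s) (C θ) := by
  have h1 : ∀ θ, HasDerivAt (fun θ => B (∫ s in a..θ, A s) (∫ s in a..θ, C s))
      (B (A θ) (∫ s in a..θ, C s) + B (∫ s in a..θ, A s) (C θ)) θ := fun θ =>
    hasDerivAt_form B (hA.hasDerivAt_primitive θ) (hC.hasDerivAt_primitive θ)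
  have i1 := hA.integrable_form' (B := B) hC.continuous_primitive
  have i2 := hC.integrable_form (B := B) hA.continuous_primitive
  have h2 := intervalIntegral.integral_eq_sub_of_hasDerivAt (a := a) (b := a + 2 * Real.pi)
    (fun θ _ => h1 θ) (i1.add i2).intervalIntegrable
  rw [← integral_eq_intervalIntegral_of_eq_zero, MeasureTheory.integral_add i1 i2,
    hA.primitive_of_le le_rfl, hA.primitive_of_ge le_rfl, hC.primitive_of_ge le_rfl] at h2
  · rw [eq_sub_iff_add_eq, h2]; simp
  · intro θ hθ
    rw [hA.eq_zero_of_notMem hθ, hC.eq_zero_of_notMem hθ]; simp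

/-- The kernel is −R⁺ for θ < θ' and −R⁻ = 2 − R⁺ for θ' < θ, hence a constant −R⁺ plus twice the
indicator of θ' < θ. The diagonal is a null set. -/
lemma integral_exchangeKernel_right {C : ℝ → E} (hC : IsTest a C) {θ : ℝ}
    (hθ : θ ∈ Ioo a (a + 2 * Real.pi)) (X : E) :
    ∫ θ', exchangeKernel B R θ θ' X (C θ') =
      B X ((2 : ℝ) • (∫ s in a..θ, C s) - Rplus R (∫ s, C s)) := by
  have := FiniteDimensional.complete ℝ E
  have i1 : MeasureTheory.Integrable fun θ' => B X (C θ') :=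
    hC.integrable_form (S := fun _ => X) continuous_const
  have i2 : MeasureTheory.Integrable fun θ' => B X (Rplus R (C θ')) :=
    (LinearMap.toContinuousLinearMap (B X ∘ₗ Rplus R)).integrable_comp hC.integrable
  have h1 : (fun θ' => exchangeKernel B R θ θ' X (C θ')) =ᵐ[MeasureTheory.volume]
      fun θ' => (2 : ℝ) * (Iic θ).indicator (fun θ' => B X (C θ')) θ' - B X (Rplus R (C θ')) := by
    have hne : ∀ᵐ θ' : ℝ, θ' ≠ θ := by simp [MeasureTheory.ae_iff]
    filter_upwards [hne] with θ' hne
    by_cases hθ' : θ' ∈ Ioo a (a + 2 * Real.pi)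
    · rcases lt_or_gt_of_ne hne with h | h
      · rw [exchangeKernel_of_gt hθ hθ' h, indicator_of_mem (mem_Iic.2 h.le), Rminus_apply,
          Rplus_apply, map_sub, map_add]
        ring
      · rw [exchangeKernel_of_lt hθ hθ' h, indicator_of_notMem (by simpa using h)]
        ring
    · rw [exchangeKernel]
      have h0 : ∀ s : Set ℝ, s.indicator (fun θ' => B X (C θ')) θ' = 0 := fun s => by
        refine indicator_apply_eq_zero.2 fun _ => ?_
        rw [hC.eq_zero_of_notMem hθ', map_zero]
      rw [h0, hC.eq_zero_of_notMem hθ']; simp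
  rw [MeasureTheory.integral_congr_ae h1, MeasureTheory.integral_sub
    ((i1.indicator measurableSet_Iic).const_mul 2) i2, MeasureTheory.integral_const_mul,
    MeasureTheory.integral_indicator measurableSet_Iic]
  have h2 : ∫ θ', B X (Rplus R (C θ')) = B X (Rplus R (∫ s, C s)) :=
    (LinearMap.toContinuousLinearMap (B X ∘ₗ Rplus R)).integral_comp_comm hC.integrable
  have h3 : ∫ θ' in Iic θ, B X (C θ') = B X (∫ s in a..θ, C s) := by
    rw [← hC.setIntegral_Iic]
    exact (LinearMap.toContinuousLinearMap (B X)).integral_comp_comm hC.integrable.integrableOn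
  rw [h2, h3, map_sub, map_smul, smul_eq_mul]

/-- All integration is moved onto the first argument, so the potential of A is its Hamiltonian
vector field up to a level factor. Skewness of R turns R⁺ into −R⁻ here. -/
lemma integral_exchangeKernel {G : Type*} [TopologicalSpace G] [ChartedSpace E G] [Group G]
    (hR : IsSplitRMatrix G B R) {A C : ℝ → E} (hA : IsTest a A) (hC : IsTest a C) :
    ∫ θ, ∫ θ', exchangeKernel B R θ θ' (A θ) (C θ') = ∫ θ, B (exchangePotential R a A θ) (C θ) := by
  have h1 : (fun θ => ∫ θ', exchangeKernel B R θ θ' (A θ) (C θ')) =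
      fun θ => 2 * B (A θ) (∫ s in a..θ, C s) - B (A θ) (Rplus R (∫ s, C s)) := by
    ext θ
    by_cases hθ : θ ∈ Ioo a (a + 2 * Real.pi)
    · rw [integral_exchangeKernel_right hC hθ, map_sub, map_smul, smul_eq_mul]
    · rw [hA.eq_zero_of_notMem hθ]; simp [exchangeKernel]
  rw [h1, MeasureTheory.integral_sub ((hA.integrable_form' hC.continuous_primitive).const_mul 2)
    (hA.integrable_form' continuous_const), MeasureTheory.integral_const_mul,
    hA.integral_form_primitive hC]
  have h2 : ∀ X, ∫ θ, B (A θ) X = B (∫ θ, A θ) X := fun X => hA.integral_form (B := B.flip) X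
  have h3 : (fun θ => B (exchangePotential R a A θ) (C θ)) =
      fun θ => B (Rplus R (∫ s, A s)) (C θ) - 2 * B (∫ s in a..θ, A s) (C θ) := by
    ext θ
    simp [exchangePotential]
  rw [h3, MeasureTheory.integral_sub (hC.integrable_form (S := fun _ => _) continuous_const)
    ((hC.integrable_form hA.continuous_primitive).const_mul 2), MeasureTheory.integral_const_mul,
    h2, hC.integral_form, hR.Rplus_left, Rminus_apply, Rplus_apply, map_sub, map_add]
  ring

end ExchangeKernel

end RealBranch

end

noncomputable section

namespace RealBranch

open Filter Topology Set

/-! ### The brackets of 𝒥 with g and with itself -/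

section Brackets

variable {E : Type*} [NormedAddCommGroup E] [NormedSpace ℝ E] [FiniteDimensional ℝ E]
  {G : Type*} [TopologicalSpace G] [ChartedSpace E G] [Group G] [LieGroup 𝓘(ℝ, E) ∞ G]
  {B : LinearMap.BilinForm ℝ E} {R : E →ₗ[ℝ] E} {a : ℝ}

omit [FiniteDimensional ℝ E] [LieGroup 𝓘(ℝ, E) ∞ G] in
lemma IsInvariantForm.eq_zero_of_forall (hB : IsInvariantForm G B) {X : E} (h : ∀ Y, B X Y = 0) :
    X = 0 := hB.nondegenerate.1 X h

lemma IsSplitRMatrix.AdR_surjective (hR : IsSplitRMatrix G B R) {d : G × G} (hd : d ∈ GR G R) :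
    Function.Surjective (AdR R d) := fun U =>
  ⟨AdR R d⁻¹ U, by simpa using hR.AdR_inv_AdR (inv_mem hd) U⟩

omit [FiniteDimensional ℝ E] in
lemma IsSplitRMatrix.form_currentGrad (hB : IsInvariantForm G B) (hR : IsSplitRMatrix G B R)
    {υp υm : ℝ} (hp : υp ≠ 0) (hm : υm ≠ 0) (hcase : υp ≠ υm → R ∘ₗ R = LinearMap.id)
    (W φ φ' U : E) :
    υm * B (currentGrad G R υp υm W φ φ') (Rminus R U) -
        υp * B (currentGrad G R υp υm W φ φ') (Rplus R U) =
      2 * (B φ' U + B φ (adCLM G (R W) U + adCLM G W (R U))) := by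
  have e : ∀ P, B φ (adCLM G P U) = - B (adCLM G P φ) U := fun P => by
    rw [hB.adCLM_left, neg_neg]
  have e' : B φ (adCLM G W (R U)) = - B (adCLM G W φ) (R U) := by
    rw [hB.adCLM_left, neg_neg]
  rw [map_add, e, e']
  by_cases h : υp = υm
  · subst h
    simp only [currentGrad, Rplus_apply, Rminus_apply, map_add, map_sub, map_smul, add_apply, sub_apply,
      LinearMap.sub_apply, LinearMap.add_apply, LinearMap.smul_apply, smul_eq_mul, hR.skew]
    field_simp
    ring
  · have hRR : ∀ X, R (R X) = X := fun X => DFunLike.congr_fun (hcase h) X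
    simp only [currentGrad, Rplus_apply, Rminus_apply, map_add, map_sub, map_smul, add_apply, sub_apply,
      LinearMap.sub_apply, LinearMap.add_apply, LinearMap.smul_apply, smul_eq_mul, hR.skew, hRR]
    field_simp
    ring

variable [ConnectedSpace G]

/-- The Hamiltonian vector field of `∫ ⟨φ, 𝒥⟩`, in the form `(Ψ^±)⁻¹ δΨ^± = S_±`. -/
lemma exists_hamiltonian_obsJ (hB : IsInvariantForm G B) (hR : IsSplitRMatrix G B R)
    {υp υm : ℝ} (hp : υp ≠ 0) (hm : υm ≠ 0) (hcase : υp ≠ υm → R ∘ₗ R = LinearMap.id)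
    {φ : ℝ → E} (hφ : IsTest a φ) (p : FactorisedField G R) :
    ∃ Ap Am Sp Sm : ℝ → E, HasGradient B a (obsJ B υp υm φ) Ap Am p ∧
      (∀ θ, HasDerivAt Sp (-(υp • Ad (p.xp θ)⁻¹
        (currentGrad G R υp υm (logGR p.xp p.xm θ 1) (φ θ) (deriv φ θ)))) θ) ∧
      (∀ θ, HasDerivAt Sm (-(υm • Ad (p.xm θ)⁻¹
        (currentGrad G R υp υm (logGR p.xp p.xm θ 1) (φ θ) (deriv φ θ)))) θ) ∧
      (∀ θ, Rplus R (Ad (p.xm θ) (Sm θ)) - Rminus R (Ad (p.xp θ) (Sp θ)) = (2 : ℝ) • φ θ) ∧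
      ∀ Cp Cm : ℝ → E, IsTest a Cp → IsTest a Cm →
        υp * (∫ θ, ∫ θ', exchangeKernel B R θ θ' (Ap θ) (Cp θ')) -
          υm * (∫ θ, ∫ θ', exchangeKernel B R θ θ' (Am θ) (Cm θ')) =
        ∫ θ, (B (Sp θ) (Cp θ) + B (Sm θ) (Cm θ)) := by
  have hpi := Real.two_pi_pos
  have hgrad := hasGradient_obsJ hB hR υp υm hφ p
  set M : ℝ → E := fun θ => currentGrad G R υp υm (logGR p.xp p.xm θ 1) (φ θ) (deriv φ θ) with hM
  set Ap : ℝ → E := fun θ => Ad (p.xp θ)⁻¹ ((1 / 2 : ℝ) • M θ) with hAp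
  set Am : ℝ → E := fun θ => Ad (p.xm θ)⁻¹ (-((1 / 2 : ℝ) • M θ)) with hAm
  have tp : IsTest a Ap := hgrad.test_p
  have tm : IsTest a Am := hgrad.test_m
  -- The level signs are those of the exchange algebra, +υ_+ and −υ_-. The potential equals R⁺∫A at
  -- a and R⁻∫A at a + 2π.
  set Sp : ℝ → E := fun θ => υp • exchangePotential R a Ap θ with hSp
  set Sm : ℝ → E := fun θ => -(υm • exchangePotential R a Am θ) with hSm
  have dSp : ∀ θ, HasDerivAt Sp (-(υp • Ad (p.xp θ)⁻¹ (M θ))) θ := by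
    intro θ
    convert! (tp.hasDerivAt_exchangePotential θ).const_smul υp using 1
    simp only [hAp, map_smul]
    module
  have dSm : ∀ θ, HasDerivAt Sm (-(υm • Ad (p.xm θ)⁻¹ (M θ))) θ := by
    intro θ
    convert! ((tm.hasDerivAt_exchangePotential θ).const_smul υm).neg using 1
    simp only [hAm, map_smul, map_neg]
    module
  refine ⟨Ap, Am, Sp, Sm, hgrad, dSp, dSm, ?_, ?_⟩
  · -- the pairing with `AdR(x) U` for constant `U` reduces the claim to an ordinary derivative
    have hd : ∀ θ, (p.xp θ, p.xm θ) ∈ GR G R := p.smooth_x.mem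
    have hder : ∀ U θ, HasDerivAt (fun θ => B (Rplus R (Sm θ) - Rminus R (Sp θ)) U -
        2 * B (φ θ) (AdR R (p.xp θ, p.xm θ) U)) 0 θ := by
      intro U θ
      have h1 : HasDerivAt (fun θ => Rplus R (Sm θ)) _ θ :=
        (LinearMap.toContinuousLinearMap (Rplus R)).hasFDerivAt.comp_hasDerivAt θ (dSm θ)
      have h2 : HasDerivAt (fun θ => Rminus R (Sp θ)) _ θ :=
        (LinearMap.toContinuousLinearMap (Rminus R)).hasFDerivAt.comp_hasDerivAt θ (dSp θ)
      have h3 := (hasDerivAt_form B (h1.sub h2) (hasDerivAt_const θ U)).sub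
        ((hasDerivAt_form B (hφ.hasDerivAt θ) (hR.hasDerivAt_AdR p.smooth_x U θ)).const_mul 2)
      convert! h3 using 1
      rw [← hR.form_currentGrad hB hp hm hcase]
      have e1 := hR.Ad_Rplus (hd θ) U
      have e2 := hR.Ad_Rminus (hd θ) U
      rw [← e1, ← e2, ← hB.Ad_inv_left, ← hB.Ad_inv_left]
      simp only [LinearMap.coe_toContinuousLinearMap', map_neg, map_smul, map_sub,
        LinearMap.sub_apply, LinearMap.neg_apply, LinearMap.smul_apply, smul_eq_mul,
        hR.Rplus_left, hR.Rminus_left, map_zero, hM]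
      ring
    have hconst : ∀ U θ, B (Rplus R (Sm θ) - Rminus R (Sp θ)) U -
        2 * B (φ θ) (AdR R (p.xp θ, p.xm θ) U) = B (Rplus R (Sm a) - Rminus R (Sp a)) U := by
      intro U θ
      have h := is_const_of_deriv_eq_zero (fun θ => (hder U θ).differentiableAt)
        (fun θ => (hder U θ).deriv) θ a
      rw [h, hφ.eq_zero_of_notMem (θ := a) (by simp)]
      simp
    have hSpa : Sp a = υp • Rplus R (∫ s, Ap s) := by simp [hSp, exchangePotential]
    have hSma : Sm a = -(υm • Rplus R (∫ s, Am s)) := by simp [hSm, exchangePotential]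
    have hSpb : Sp (a + 2 * Real.pi) = υp • Rminus R (∫ s, Ap s) := by
      simp only [hSp, exchangePotential, tp.primitive_of_ge le_rfl, Rplus_apply, Rminus_apply]
      module
    have hSmb : Sm (a + 2 * Real.pi) = -(υm • Rminus R (∫ s, Am s)) := by
      simp only [hSm, exchangePotential, tm.primitive_of_ge le_rfl, Rplus_apply, Rminus_apply]
      module
    -- The pairing is constant and φ vanishes at both ends, so R⁺S_- − R⁻S_+ agrees at a and a + 2π;
    -- there S_± jump by multiples of ∫A because R⁺ − R⁻ = 2.
    have hE : υm • Rplus R (∫ s, Am s) + υp • Rminus R (∫ s, Ap s) = 0 := by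
      refine hB.eq_zero_of_forall fun U => ?_
      have h := hconst U (a + 2 * Real.pi)
      rw [hφ.eq_zero_of_notMem (θ := a + 2 * Real.pi) (by simp), hSpa, hSma, hSpb, hSmb] at h
      simp only [Rplus_apply, Rminus_apply, map_add, map_sub, map_smul, map_neg, map_zero,
        LinearMap.add_apply, LinearMap.sub_apply, LinearMap.smul_apply, LinearMap.neg_apply,
        LinearMap.zero_apply, smul_eq_mul] at h ⊢
      linarith
    -- Since R⁺ and R⁻ commute, the value at a is −R⁺ applied to the left side of `hE`.
    have ha0 : Rplus R (Sm a) - Rminus R (Sp a) = 0 := by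
      have h := congrArg (Rplus R) hE
      rw [hSpa, hSma]
      rw [map_zero] at h
      rw [← neg_eq_zero, ← h]
      simp only [Rplus_apply, Rminus_apply, map_add, map_sub, map_smul, map_neg]
      module
    intro θ
    rw [← sub_eq_zero]
    refine hB.eq_zero_of_forall fun X => ?_
    -- Transported vectors AdR(x)U exhaust 𝔤, so vanishing of these pairings gives the vector
    -- identity.
    obtain ⟨U, rfl⟩ := hR.AdR_surjective (hd θ) X
    have h := hconst U θ
    rw [ha0] at h
    have e1 := hR.Ad_Rplus (hd θ) U
    have e2 := hR.Ad_Rminus (hd θ) U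
    simp only at e1 e2
    rw [map_sub, map_sub, LinearMap.sub_apply, LinearMap.sub_apply, hR.Rplus_left, hR.Rminus_left,
      ← e1, ← e2, hB.Ad_Ad, hB.Ad_Ad, map_smul B (2 : ℝ) (φ θ), LinearMap.smul_apply, smul_eq_mul]
    rw [map_sub, LinearMap.sub_apply, hR.Rplus_left, hR.Rminus_left] at h
    simp only [LinearMap.zero_apply, map_zero] at h
    exact h
  · intro Cp Cm hCp hCm
    rw [integral_exchangeKernel hR tp hCp, integral_exchangeKernel hR tm hCm,
      ← MeasureTheory.integral_const_mul, ← MeasureTheory.integral_const_mul,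
      ← MeasureTheory.integral_sub]
    · congr 1 with θ
      simp only [hSp, hSm, map_smul, map_neg, LinearMap.smul_apply, LinearMap.neg_apply, smul_eq_mul]
      ring
    · exact (hCp.integrable_form (continuous_iff_continuousAt.2 fun θ =>
        (tp.hasDerivAt_exchangePotential θ).continuousAt)).const_mul _
    · exact (hCm.integrable_form (continuous_iff_continuousAt.2 fun θ =>
        (tm.hasDerivAt_exchangePotential θ).continuousAt)).const_mul _

/-- The Hamiltonian field of 𝒥 has ε = φ, so it acts on g by the left-invariant vector field of φ.
-/
lemma hasBracket_Jg (hB : IsInvariantForm G B) (hR : IsSplitRMatrix G B R)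
    {υp υm : ℝ} (hp : υp ≠ 0) (hm : υm ≠ 0) (hcase : υp ≠ υm → R ∘ₗ R = LinearMap.id)
    {φ : ℝ → E} (hφ : IsTest a φ) {f : G → ℝ} (hf : ContMDiff 𝓘(ℝ, E) 𝓘(ℝ, ℝ) ∞ f) {ψ : ℝ → ℝ}
    (hψ : IsTest a ψ) (p : FactorisedField G R) :
    HasBracket B υp υm a (obsJ B υp υm φ) (obsG f ψ) p
      (∫ θ, ψ θ * leftInvDeriv f (φ θ) (p.g θ)) := by
  obtain ⟨Ap, Am, Sp, Sm, hgrad, -, -, hε, hint⟩ :=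
    exists_hamiltonian_obsJ hB hR hp hm hcase hφ p
  have hg := hasGradient_obsG hB hR hf hψ p
  refine ⟨_, _, _, _, hgrad, hg, ?_⟩
  rw [hint _ _ hg.test_p hg.test_m]
  congr 1 with θ
  rw [← form_leftGrad hB.nondegenerate, hB.symm (Sp θ), hB.symm (Sm θ), hB.Ad_inv_left,
    hB.Ad_inv_left]
  have h := congrArg (B (leftGrad B hB.nondegenerate f (p.g θ))) (hε θ)
  simp only [map_sub, map_smul, map_neg, LinearMap.smul_apply, LinearMap.neg_apply, smul_eq_mul,
    hR.Rplus_left, hR.Rminus_left] at h ⊢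
  linear_combination (-ψ θ / 2) * h

lemma hasBracket_JJ (hB : IsInvariantForm G B) (hR : IsSplitRMatrix G B R)
    {υp υm : ℝ} (hp : υp ≠ 0) (hm : υm ≠ 0) (hcase : υp ≠ υm → R ∘ₗ R = LinearMap.id)
    {φ ψ : ℝ → E} (hφ : IsTest a φ) (hψ : IsTest a ψ) (p : FactorisedField G R) :
    HasBracket B υp υm a (obsJ B υp υm φ) (obsJ B υp υm ψ) p
      (-(∫ θ, B (lieBr G (φ θ) (currentJ υp υm p θ)) (ψ θ))
        + ((1 / 2) * (υm⁻¹ - υp⁻¹)) * ∫ θ, B (deriv φ θ) (ψ θ)) := by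
  obtain ⟨Ap, Am, Sp, Sm, hgrad, dSp, dSm, hε, hint⟩ :=
    exists_hamiltonian_obsJ hB hR hp hm hcase hφ p
  have hg := hasGradient_obsJ hB hR υp υm hψ p
  refine ⟨_, _, _, _, hgrad, hg, ?_⟩
  rw [hint _ _ hg.test_p hg.test_m]
  set W : ℝ → E := fun θ => logGR p.xp p.xm θ 1 with hW
  set ηp : ℝ → E := fun θ => Ad (p.xp θ) (Sp θ) with hηp
  set ηm : ℝ → E := fun θ => Ad (p.xm θ) (Sm θ) with hηm
  set M : ℝ → E := fun θ => currentGrad G R υp υm (W θ) (φ θ) (deriv φ θ) with hM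
  have dηp : ∀ θ, HasDerivAt ηp (adCLM G (Rplus R (W θ)) (ηp θ) - υp • M θ) θ := fun θ => by
    convert! hasDerivAt_Ad p.smooth_x.smooth_p (dSp θ) using 1
    rw [p.smooth_x.rightLog_p]
    simp [hηp, hM, hW, sub_eq_add_neg]
  have dηm : ∀ θ, HasDerivAt ηm (adCLM G (Rminus R (W θ)) (ηm θ) - υm • M θ) θ := fun θ => by
    convert! hasDerivAt_Ad p.smooth_x.smooth_m (dSm θ) using 1
    rw [p.smooth_x.rightLog_m]
    simp [hηm, hM, hW, sub_eq_add_neg]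
  have cηp : Continuous ηp := continuous_iff_continuousAt.2 fun θ => (dηp θ).continuousAt
  have cηm : Continuous ηm := continuous_iff_continuousAt.2 fun θ => (dηm θ).continuousAt
  have hWs : ContDiff ℝ ∞ W := p.smooth_x.contDiff_logGR 1
  set J : ℝ → E := currentJ υp υm p with hJdef
  have hJ : ∀ θ, J θ = (1 / 2 : ℝ) • (υp⁻¹ • Rplus R (W θ) - υm⁻¹ • Rminus R (W θ)) := fun θ => by
    rw [hJdef, currentJ, p.smooth_x.rightLog_p, p.smooth_x.rightLog_m]
  have cJ : Continuous J := by
    rw [funext hJ]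
    exact ((((contDiff_linearMap _ hWs).const_smul _).sub
      ((contDiff_linearMap _ hWs).const_smul _)).const_smul _).continuous
  -- This is η_+ = ε + R⁺Y with ε = φ and Y = (η_+ − η_-)/2, obtained from the relation for ε alone.
  have hYp : ∀ θ, Rplus R (ηp θ - ηm θ) = (2 : ℝ) • (ηp θ - φ θ) := fun θ => by
    rw [smul_sub, ← hε]
    simp only [Rplus_apply, Rminus_apply, map_sub]
    module
  have hYm : ∀ θ, Rminus R (ηp θ - ηm θ) = (2 : ℝ) • (ηm θ - φ θ) := fun θ => by
    rw [smul_sub, ← hε]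
    simp only [Rplus_apply, Rminus_apply, map_sub]
    module
  have i1 : MeasureTheory.Integrable fun θ => B (lieBr G (φ θ) (J θ)) (ψ θ) := by
    simp only [lieBr_eq_adCLM]
    exact hψ.integrable_form
      (((adCLM (E := E) G).continuous.comp hφ.smooth.continuous).clm_apply cJ)
  have i2 : MeasureTheory.Integrable fun θ => B (deriv φ θ) (ψ θ) :=
    hψ.integrable_form hφ.contDiff_deriv.continuous
  have cSp : Continuous Sp := continuous_iff_continuousAt.2 fun θ => (dSp θ).continuousAt
  have cSm : Continuous Sm := continuous_iff_continuousAt.2 fun θ => (dSm θ).continuousAt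
  have i3 := (hg.test_p.integrable_form (B := B) cSp).add (hg.test_m.integrable_form (B := B) cSm)
  have i4 := i1.neg.add (i2.const_mul ((1 / 2) * (υm⁻¹ - υp⁻¹)))
  have hderiv : ∀ θ, HasDerivAt (fun θ => (1 / 2 : ℝ) * (υm⁻¹ * B (ηm θ - φ θ) (ψ θ) -
      υp⁻¹ * B (ηp θ - φ θ) (ψ θ))) _ θ := fun θ =>
    (((hasDerivAt_form B ((dηm θ).sub (hφ.hasDerivAt θ)) (hψ.hasDerivAt θ)).const_mul υm⁻¹).sub
      ((hasDerivAt_form B ((dηp θ).sub (hφ.hasDerivAt θ)) (hψ.hasDerivAt θ)).const_mul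
        υp⁻¹)).const_mul (1 / 2 : ℝ)
  -- The bracket density minus the asserted one is an exact derivative. The inverse levels in the
  -- primitive cancel υ_±M in the equations for η_±, so the two M-terms annihilate each other.
  have hpt : ∀ θ, HasDerivAt (fun θ => (1 / 2 : ℝ) * (υm⁻¹ * B (ηm θ - φ θ) (ψ θ) -
      υp⁻¹ * B (ηp θ - φ θ) (ψ θ)))
      ((B (Sp θ) (Ad (p.xp θ)⁻¹ ((1 / 2 : ℝ) • currentGrad G R υp υm (W θ) (ψ θ) (deriv ψ θ))) +
        B (Sm θ) (Ad (p.xm θ)⁻¹ (-((1 / 2 : ℝ) •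
          currentGrad G R υp υm (W θ) (ψ θ) (deriv ψ θ))))) -
        (-B (lieBr G (φ θ) (J θ)) (ψ θ) +
          ((1 / 2) * (υm⁻¹ - υp⁻¹)) * B (deriv φ θ) (ψ θ))) θ := by
    intro θ
    convert! hderiv θ using 1
    rw [hB.symm (Sp θ), hB.symm (Sm θ), hB.Ad_inv_left, hB.Ad_inv_left]
    have h1 : B ((1 / 2 : ℝ) • currentGrad G R υp υm (W θ) (ψ θ) (deriv ψ θ)) (ηp θ) +
        B (-((1 / 2 : ℝ) • currentGrad G R υp υm (W θ) (ψ θ) (deriv ψ θ))) (ηm θ) =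
        (1 / 2 : ℝ) * (υm⁻¹ * B (deriv ψ θ - adCLM G (Rminus R (W θ)) (ψ θ)) (ηm θ - φ θ) -
          υp⁻¹ * B (deriv ψ θ - adCLM G (Rplus R (W θ)) (ψ θ)) (ηp θ - φ θ)) := by
      have h2 : ∀ X, B (Rminus R X) (ηp θ - ηm θ) = -(2 * B X (ηp θ - φ θ)) := fun X => by
        rw [hR.Rminus_left, hYp, map_smul, smul_eq_mul]
      have h3 : ∀ X, B (Rplus R X) (ηp θ - ηm θ) = -(2 * B X (ηm θ - φ θ)) := fun X => by
        rw [hR.Rplus_left, hYm, map_smul, smul_eq_mul]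
      rw [map_neg, LinearMap.neg_apply, ← sub_eq_add_neg, ← map_sub]
      simp only [currentGrad, map_smul, map_sub (B), LinearMap.smul_apply, LinearMap.sub_apply,
        smul_eq_mul, h2, h3]
      ring
    change B _ (ηp θ) + B _ (ηm θ) - _ = _
    rw [h1, hB.symm, hB.symm (deriv ψ θ - adCLM G (Rplus R (W θ)) (ψ θ)), lieBr_eq_adCLM,
      adCLM_swap (φ θ), hJ]
    have h4 : ∀ X P : E, B X (adCLM G P (ψ θ)) = - B (adCLM G P X) (ψ θ) := fun X P => by
      rw [hB.adCLM_left, neg_neg]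
    simp only [map_sub, map_neg, map_smul, LinearMap.sub_apply, LinearMap.neg_apply,
      LinearMap.smul_apply, Pi.sub_apply, sub_apply, smul_apply, smul_eq_mul, h4]
    field_simp
    ring
  have i5 : MeasureTheory.Integrable fun θ => (1 / 2 : ℝ) * (υm⁻¹ * B (ηm θ - φ θ) (ψ θ) -
      υp⁻¹ * B (ηp θ - φ θ) (ψ θ)) :=
    (((hψ.integrable_form (cηm.sub hφ.smooth.continuous)).const_mul _).sub
      ((hψ.integrable_form (cηp.sub hφ.smooth.continuous)).const_mul _)).const_mul _
  have h0 := MeasureTheory.integral_eq_zero_of_hasDerivAt_of_integrable hpt (i3.sub i4) i5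
  have h5 := MeasureTheory.integral_sub i3 i4
  have h6 := MeasureTheory.integral_add i1.neg (i2.const_mul ((1 / 2) * (υm⁻¹ - υp⁻¹)))
  simp only [Pi.add_apply, Pi.neg_apply, MeasureTheory.integral_neg,
    MeasureTheory.integral_const_mul] at h0 h5 h6
  rw [h5, h6] at h0
  exact (sub_eq_zero.1 h0).symm

end Brackets

end RealBranch

end

noncomputable section

namespace RealBranch

open Filter Topology Set

/-! ### The bracket of g with g, and necessity of R² = 1 -/

section Nonvanishing

/-- A smooth function which does not vanish at a point is detected by a test function supported
near that point. -/
lemma exists_isTest_integral_ne_zero {a t₀ : ℝ} {I : Set ℝ} (hI : IsOpen I) (ht₀ : t₀ ∈ I)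
    (hIa : I ⊆ Ioo a (a + 2 * Real.pi)) {F : ℝ → ℝ} (hF : ContDiff ℝ ∞ F) (hF0 : F t₀ ≠ 0) :
    ∃ φ : ℝ → ℝ, IsTest a φ ∧ (∀ θ, θ ∉ I → φ θ = 0) ∧ ∫ θ, φ θ * F θ ≠ 0 := by
  obtain ⟨b, hbsub, hbc, hbs, hbr, hb1⟩ := exists_contDiff_tsupport_subset (n := ⊤) (hI.mem_nhds ht₀)
  have tb : IsTest a b := ⟨hbs, hbc, hbsub.trans hIa⟩
  -- Multiplying the bump by F itself makes the integrand b F² nonnegative and positive at t₀.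
  refine ⟨fun θ => b θ * F θ, tb.of_eq_zero (hbs.mul hF) fun θ hθ => ?_, fun θ hθ => ?_, ?_⟩
  · rw [image_eq_zero_of_notMem_tsupport hθ, zero_mul]
  · change b θ * F θ = 0
    rw [image_eq_zero_of_notMem_tsupport fun h => hθ (hbsub h), zero_mul]
  · refine ne_of_gt (Continuous.integral_pos_of_hasCompactSupport_nonneg_nonzero (x := t₀)
      ((hbs.continuous.mul hF.continuous).mul hF.continuous) (hbc.mul_right.mul_right) (fun θ => ?_) ?_)
    · have : 0 ≤ b θ := (hbr (mem_range_self θ)).1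
      rw [Pi.zero_apply, mul_assoc]
      exact mul_nonneg this (mul_self_nonneg _)
    · simp [hb1, hF0]

variable {E : Type*} [NormedAddCommGroup E] [NormedSpace ℝ E] [FiniteDimensional ℝ E]
  {G : Type*} [TopologicalSpace G] [ChartedSpace E G] [Group G] [LieGroup 𝓘(ℝ, E) ∞ G]
  {B : LinearMap.BilinForm ℝ E} {R : E →ₗ[ℝ] E} {a : ℝ}

/-- Smooth functions on `G` with prescribed differential at a point. -/
lemma exists_contMDiff_leftInvDeriv [T2Space G] (x : G) (l : E →ₗ[ℝ] ℝ) :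
    ∃ f : G → ℝ, ContMDiff 𝓘(ℝ, E) 𝓘(ℝ, ℝ) ∞ f ∧ ∀ X, leftInvDeriv f X x = l X := by
  obtain ⟨ρ⟩ : Nonempty (SmoothBumpFunction 𝓘(ℝ, E) (1 : G)) := inferInstance
  let l' : E →L[ℝ] ℝ := LinearMap.toContinuousLinearMap l
  -- A linear function in the chart at 1, cut off by a bump; left translation moves it to x and
  -- preserves left-invariant derivatives.
  have hsm : ContMDiff 𝓘(ℝ, E) 𝓘(ℝ, ℝ) ∞ fun y => ρ y • l' (extChartAt 𝓘(ℝ, E) (1 : G) y) :=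
    ρ.contMDiff_smul (l'.contMDiff.comp_contMDiffOn contMDiffOn_extChartAt)
  refine ⟨fun y => ρ (x⁻¹ * y) • l' (extChartAt 𝓘(ℝ, E) (1 : G) (x⁻¹ * y)),
    contMDiff_fun_comp_mul_left hsm x⁻¹, fun X => ?_⟩
  have e : (fun y => ρ (x⁻¹ * (x * y)) • l' (extChartAt 𝓘(ℝ, E) (1 : G) (x⁻¹ * (x * y)))) =
      fun y => ρ y • l' (extChartAt 𝓘(ℝ, E) (1 : G) y) := by
    ext y; rw [inv_mul_cancel_left]
  have h0 := mfderiv_eq_fderiv_oneChartSymm (V := ℝ) (hsm.mdifferentiable (by simp) (1 : G)) X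
  rw [← e] at h0
  refine h0.trans ?_
  have h1 : ∀ᶠ b in 𝓝 (oneCoord G : E), ρ (oneChartSymm G b) = 1 :=
    (contMDiffAt_oneChartSymm (E := E) (G := G)).continuousAt.eventually
      (by rw [oneChartSymm_oneCoord]; exact ρ.eventuallyEq_one)
  have h2 : (fun b : E => ρ (oneChartSymm G b) • l' (extChartAt 𝓘(ℝ, E) (1 : G) (oneChartSymm G b)))
      =ᶠ[𝓝 (oneCoord G : E)] l' := by
    filter_upwards [h1, eventually_oneChart_oneChartSymm (E := E) (G := G)] with b hb1 hb2
    rw [hb1, one_smul]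
    exact congrArg l' hb2
  rw [h2.fderiv_eq, ContinuousLinearMap.fderiv]
  rfl

lemma exists_leftGrad_eq [T2Space G] (hB : B.Nondegenerate) (x : G) (X : E) :
    ∃ f : G → ℝ, ContMDiff 𝓘(ℝ, E) 𝓘(ℝ, ℝ) ∞ f ∧ leftGrad B hB f x = X := by
  obtain ⟨f, hf, h⟩ := exists_contMDiff_leftInvDeriv x (B X)
  refine ⟨f, hf, ?_⟩
  rw [← sub_eq_zero]
  refine hB.1 _ fun Y => ?_
  rw [map_sub, LinearMap.sub_apply, form_leftGrad, h, sub_self]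

-- Skewness replaces R⁺ on the left by −R⁻ on the right, and R⁻R⁺ = R² − 1. The minus version has
-- the same right-hand side.
omit [FiniteDimensional ℝ E] [LieGroup 𝓘(ℝ, E) ∞ G] in
lemma IsSplitRMatrix.form_Rplus_Rplus (hR : IsSplitRMatrix G B R) (L : E →ₗ[ℝ] E)
    (hL : ∀ X, R (L X) = L (R X)) (Z Z' : E) :
    B (Rplus R Z) (L (Rplus R Z')) = - B Z (R (R (L Z')) - L Z') := by
  simp only [Rplus_apply, map_add, map_sub, LinearMap.add_apply, hR.skew, hL]
  ring

omit [FiniteDimensional ℝ E] [LieGroup 𝓘(ℝ, E) ∞ G] in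
lemma IsSplitRMatrix.form_Rminus_Rminus (hR : IsSplitRMatrix G B R) (L : E →ₗ[ℝ] E)
    (hL : ∀ X, R (L X) = L (R X)) (Z Z' : E) :
    B (Rminus R Z) (L (Rminus R Z')) = - B Z (R (R (L Z')) - L Z') := by
  simp only [Rminus_apply, map_sub, LinearMap.sub_apply, hR.skew, hL]
  ring

omit [NormedSpace ℝ E] [FiniteDimensional ℝ E] in
lemma R_Rplus [NormedSpace ℝ E] (R : E →ₗ[ℝ] E) (X : E) : R (Rplus R X) = Rplus R (R X) := by
  simp [Rplus_apply]

omit [NormedSpace ℝ E] [FiniteDimensional ℝ E] in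
lemma R_Rminus [NormedSpace ℝ E] (R : E →ₗ[ℝ] E) (X : E) : R (Rminus R X) = Rminus R (R X) := by
  simp [Rminus_apply]

/-- `AdR(x)⁻¹ ∇f`, the gradient of `f(g)` transported to the frame of `Ψ`. -/
def movedGrad (hB : IsInvariantForm G B) (f : G → ℝ) (p : FactorisedField G R) (θ : ℝ) : E :=
  AdR R ((p.xp θ)⁻¹, (p.xm θ)⁻¹) (leftGrad B hB.nondegenerate f (p.g θ))

lemma contDiff_movedGrad (hB : IsInvariantForm G B) {f : G → ℝ}
    (hf : ContMDiff 𝓘(ℝ, E) 𝓘(ℝ, ℝ) ∞ f) (p : FactorisedField G R) :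
    ContDiff ℝ ∞ (movedGrad hB f p) :=
  (contDiff_AdR p.smooth_x.smooth_p.inv p.smooth_x.smooth_m.inv).clm_apply
    (contDiff_leftGrad _ hf p.smooth_g)

variable [ConnectedSpace G]

lemma hasGradient_obsG_movedGrad (hB : IsInvariantForm G B) (hR : IsSplitRMatrix G B R) {f : G → ℝ}
    (hf : ContMDiff 𝓘(ℝ, E) 𝓘(ℝ, ℝ) ∞ f) {φ : ℝ → ℝ} (hφ : IsTest a φ) (p : FactorisedField G R) :
    HasGradient B a (obsG f φ) (fun θ => (φ θ / 2) • Rplus R (movedGrad hB f p θ))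
      (fun θ => -((φ θ / 2) • Rminus R (movedGrad hB f p θ))) p := by
  convert! hasGradient_obsG hB hR hf hφ p using 2 with θ θ
  · have h := hR.Ad_Rplus (inv_mem (p.smooth_x.mem θ)) (leftGrad B hB.nondegenerate f (p.g θ))
    rw [map_smul]
    exact congrArg _ h.symm
  · have h := hR.Ad_Rminus (inv_mem (p.smooth_x.mem θ)) (leftGrad B hB.nondegenerate f (p.g θ))
    rw [map_neg, map_smul]
    exact congrArg _ (congrArg _ h.symm)

omit [FiniteDimensional ℝ E] [LieGroup 𝓘(ℝ, E) ∞ G] [ConnectedSpace G] in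
/-- Both chiral halves give the same contraction. -/
lemma IsSplitRMatrix.exchangeKernel_chiral (hR : IsSplitRMatrix G B R) (θ θ' r s : ℝ) (Z Z' : E) :
    exchangeKernel B R θ θ' (-(r • Rminus R Z)) (-(s • Rminus R Z')) =
      exchangeKernel B R θ θ' (r • Rplus R Z) (s • Rplus R Z') := by
  simp only [exchangeKernel, map_neg, map_smul, LinearMap.neg_apply, LinearMap.smul_apply,
    hR.form_Rplus_Rplus _ (R_Rplus R), hR.form_Rplus_Rplus _ (R_Rminus R),
    hR.form_Rminus_Rminus _ (R_Rplus R), hR.form_Rminus_Rminus _ (R_Rminus R),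
    smul_eq_mul]
  ring

/-- The chiral halves have equal contractions and enter with coefficients υ_+ and −υ_-. -/
lemma hasBracket_gg (hB : IsInvariantForm G B) (hR : IsSplitRMatrix G B R) (υp υm : ℝ)
    {f h : G → ℝ} (hf : ContMDiff 𝓘(ℝ, E) 𝓘(ℝ, ℝ) ∞ f) (hh : ContMDiff 𝓘(ℝ, E) 𝓘(ℝ, ℝ) ∞ h)
    {φ ψ : ℝ → ℝ} (hφ : IsTest a φ) (hψ : IsTest a ψ) (p : FactorisedField G R) :
    HasBracket B υp υm a (obsG f φ) (obsG h ψ) p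
      ((υp - υm) * ∫ θ, ∫ θ', exchangeKernel B R θ θ' ((φ θ / 2) • Rplus R (movedGrad hB f p θ))
        ((ψ θ' / 2) • Rplus R (movedGrad hB h p θ'))) := by
  refine ⟨_, _, _, _, hasGradient_obsG_movedGrad hB hR hf hφ p,
    hasGradient_obsG_movedGrad hB hR hh hψ p, ?_⟩
  simp only [hR.exchangeKernel_chiral]
  ring

lemma hasBracket_gg_zero (hB : IsInvariantForm G B) (hR : IsSplitRMatrix G B R) {υp υm : ℝ}
    (hcase : υp ≠ υm → R ∘ₗ R = LinearMap.id)
    {f h : G → ℝ} (hf : ContMDiff 𝓘(ℝ, E) 𝓘(ℝ, ℝ) ∞ f) (hh : ContMDiff 𝓘(ℝ, E) 𝓘(ℝ, ℝ) ∞ h)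
    {φ ψ : ℝ → ℝ} (hφ : IsTest a φ) (hψ : IsTest a ψ) (p : FactorisedField G R) :
    HasBracket B υp υm a (obsG f φ) (obsG h ψ) p 0 := by
  convert! hasBracket_gg hB hR υp υm hf hh hφ hψ p using 1
  by_cases hυ : υp = υm
  · rw [hυ, sub_self, zero_mul]
  · have hRR : ∀ X, R (R X) = X := fun X => DFunLike.congr_fun (hcase hυ) X
    simp [exchangeKernel, hR.form_Rplus_Rplus _ (R_Rplus R), hR.form_Rplus_Rplus _ (R_Rminus R), hRR]

/-- On I × I' the kernel is the constant −L, so the bracket becomes a double integral of ⟨Z, (R² −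
1)L Z'⟩; the gradients Z, Z' can be prescribed at one point each and then localised there. -/
lemma exists_bracket_ne_zero_of_region [T2Space G] (hB : IsInvariantForm G B)
    (hR : IsSplitRMatrix G B R) {υp υm : ℝ} (hυ : υp ≠ υm) (L : E →ₗ[ℝ] E)
    (hL : ∀ X, R (L X) = L (R X)) {U' : E} (hU' : R (R (L U')) - L U' ≠ 0) {I I' : Set ℝ}
    (hI : IsOpen I) (hI' : IsOpen I') (hIa : I ⊆ Ioo a (a + 2 * Real.pi))
    (hIa' : I' ⊆ Ioo a (a + 2 * Real.pi)) (hIne : I.Nonempty) (hIne' : I'.Nonempty)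
    (hK : ∀ θ ∈ I, ∀ θ' ∈ I', ∀ X Y, exchangeKernel B R θ θ' X Y = - B X (L Y))
    (p : FactorisedField G R) :
    ∃ (f h : G → ℝ) (φ ψ : ℝ → ℝ) (v : ℝ), ContMDiff 𝓘(ℝ, E) 𝓘(ℝ, ℝ) ∞ f ∧
      ContMDiff 𝓘(ℝ, E) 𝓘(ℝ, ℝ) ∞ h ∧ IsTest a φ ∧ IsTest a ψ ∧ v ≠ 0 ∧
      HasBracket B υp υm a (obsG f φ) (obsG h ψ) p v := by
  have hcomplete := FiniteDimensional.complete ℝ E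
  obtain ⟨t, ht⟩ := hIne
  obtain ⟨t', ht'⟩ := hIne'
  let T : E →ₗ[ℝ] E := R ∘ₗ R ∘ₗ L - L
  obtain ⟨U, hU⟩ : ∃ U, B U (T U') ≠ 0 := by
    by_contra! hcon
    exact hU' (hB.eq_zero_of_forall fun Y => by rw [hB.symm]; exact hcon Y)
  have hgrad : ∀ (s : ℝ) (X : E), ∃ f : G → ℝ, ContMDiff 𝓘(ℝ, E) 𝓘(ℝ, ℝ) ∞ f ∧
      movedGrad hB f p s = X := fun s X => by
    obtain ⟨f, hf, hfX⟩ := exists_leftGrad_eq hB.nondegenerate (p.g s) (AdR R (p.xp s, p.xm s) X)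
    refine ⟨f, hf, ?_⟩
    rw [movedGrad, hfX]
    exact hR.AdR_inv_AdR (p.smooth_x.mem s) X
  obtain ⟨f, hf, hfU⟩ := hgrad t U
  obtain ⟨h, hh, hhU⟩ := hgrad t' U'
  have hZf := contDiff_movedGrad hB hf p
  have hZh := contDiff_movedGrad hB hh p
  -- ψ is fixed first: it turns the inner integral into pairing with one vector T w, and only then
  -- is φ chosen against it.
  obtain ⟨ψ, hψ, hψI, hψ0⟩ := exists_isTest_integral_ne_zero hI' ht' hIa'
    (F := fun s => B U (T (movedGrad hB h p s)))
    (contDiff_form B contDiff_const (contDiff_linearMap T hZh)) (by rw [hhU]; exact hU)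
  have hψZ : IsTest a fun s => ψ s • movedGrad hB h p s :=
    hψ.of_eq_zero (hψ.smooth.smul hZh) fun s hs => by
      rw [image_eq_zero_of_notMem_tsupport hs, zero_smul]
  set w : E := ∫ s, ψ s • movedGrad hB h p s with hw
  have hint : ∀ X, ∫ s, ψ s * B X (T (movedGrad hB h p s)) = B X (T w) := fun X => by
    have := (LinearMap.toContinuousLinearMap (B X ∘ₗ T)).integral_comp_comm hψZ.integrable
    simpa using this
  rw [hint] at hψ0
  obtain ⟨φ, hφ, hφI, hφ0⟩ := exists_isTest_integral_ne_zero hI ht hIa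
    (F := fun s => B (movedGrad hB f p s) (T w))
    (contDiff_form B hZf contDiff_const) (by rw [hfU]; exact hψ0)
  refine ⟨f, h, φ, ψ, _, hf, hh, hφ, hψ, ?_, hasBracket_gg hB hR υp υm hf hh hφ hψ p⟩
  have hker : ∀ θ θ', exchangeKernel B R θ θ' ((φ θ / 2) • Rplus R (movedGrad hB f p θ))
      ((ψ θ' / 2) • Rplus R (movedGrad hB h p θ')) =
      (φ θ / 4) * (ψ θ' * B (movedGrad hB f p θ) (T (movedGrad hB h p θ'))) := by
    intro θ θ'
    by_cases hθ : θ ∈ I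
    · by_cases hθ' : θ' ∈ I'
      · rw [hK θ hθ θ' hθ', map_smul L, map_smul, map_smul, LinearMap.smul_apply,
          hR.form_Rplus_Rplus L hL]
        simp only [T, smul_eq_mul, LinearMap.sub_apply, LinearMap.comp_apply]
        ring
      · simp [hψI θ' hθ', exchangeKernel]
    · simp [hφI θ hθ, exchangeKernel]
  simp only [hker, MeasureTheory.integral_const_mul, hint]
  have : ∀ θ, φ θ / 4 * B (movedGrad hB f p θ) (T w) =
      (1 / 4) * (φ θ * B (movedGrad hB f p θ) (T w)) := fun θ => by ring
  simp only [this, MeasureTheory.integral_const_mul]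
  exact mul_ne_zero (sub_ne_zero.2 hυ) (mul_ne_zero (by norm_num) hφ0)

/-- Supports in opposite halves of the interval fix the order of θ and θ', which selects R⁺ or R⁻.
-/
lemma exists_bracket_ne_zero [T2Space G] (hB : IsInvariantForm G B)
    (hR : IsSplitRMatrix G B R) {υp υm : ℝ} (hυ : υp ≠ υm) (hRR : R ∘ₗ R ≠ LinearMap.id)
    (p : FactorisedField G R) (a : ℝ) :
    ∃ (f h : G → ℝ) (φ ψ : ℝ → ℝ) (v : ℝ), ContMDiff 𝓘(ℝ, E) 𝓘(ℝ, ℝ) ∞ f ∧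
      ContMDiff 𝓘(ℝ, E) 𝓘(ℝ, ℝ) ∞ h ∧ IsTest a φ ∧ IsTest a ψ ∧ v ≠ 0 ∧
      HasBracket B υp υm a (obsG f φ) (obsG h ψ) p v := by
  have hpi := Real.pi_pos
  have s1 : Ioo a (a + Real.pi) ⊆ Ioo a (a + 2 * Real.pi) := Ioo_subset_Ioo_right (by linarith)
  have s2 : Ioo (a + Real.pi) (a + 2 * Real.pi) ⊆ Ioo a (a + 2 * Real.pi) :=
    Ioo_subset_Ioo_left (by linarith)
  have n1 : (Ioo a (a + Real.pi)).Nonempty := nonempty_Ioo.2 (by linarith)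
  have n2 : (Ioo (a + Real.pi) (a + 2 * Real.pi)).Nonempty := nonempty_Ioo.2 (by linarith)
  by_cases h1 : ∃ U', R (R (Rplus R U')) - Rplus R U' ≠ 0
  · obtain ⟨U', hU'⟩ := h1
    exact exists_bracket_ne_zero_of_region hB hR hυ (Rplus R) (R_Rplus R) hU' isOpen_Ioo isOpen_Ioo
      s1 s2 n1 n2 (fun θ hθ θ' hθ' => exchangeKernel_of_lt (s1 hθ) (s2 hθ') (hθ.2.trans hθ'.1)) p
  by_cases h2 : ∃ U', R (R (Rminus R U')) - Rminus R U' ≠ 0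
  · obtain ⟨U', hU'⟩ := h2
    exact exists_bracket_ne_zero_of_region hB hR hυ (Rminus R) (R_Rminus R) hU' isOpen_Ioo isOpen_Ioo
      s2 s1 n2 n1 (fun θ hθ θ' hθ' => exchangeKernel_of_gt (s2 hθ) (s1 hθ') (hθ'.2.trans hθ.1)) p
  · push Not at h1 h2
    refine absurd (LinearMap.ext fun X => ?_) hRR
    have e1 := h1 X
    have e2 := h2 X
    simp only [Rplus_apply, Rminus_apply, map_add, map_sub] at e1 e2
    -- If (R² − 1)R⁺ and (R² − 1)R⁻ both vanish, so does their difference 2(R² − 1).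
    have : (2 : ℝ) • (R (R X) - X) = 0 := by
      linear_combination (norm := module) e1 - e2
    rw [smul_eq_zero_iff_right (by norm_num), sub_eq_zero] at this
    exact this

end Nonvanishing

/-! ### Smoothness and periodicity of 𝒥; equal levels -/

section Currents

variable {E : Type*} [NormedAddCommGroup E] [NormedSpace ℝ E]
  {G : Type*} [TopologicalSpace G] [ChartedSpace E G] [Group G] [LieGroup 𝓘(ℝ, E) ∞ G]
  {R : E →ₗ[ℝ] E}

lemma contDiff_currentJ (υp υm : ℝ) (p : FactorisedField G R) :
    ContDiff ℝ ∞ (currentJ υp υm p) :=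
  (((contDiff_rightLog p.smooth_x.smooth_p 1).const_smul _).sub
    ((contDiff_rightLog p.smooth_x.smooth_m 1).const_smul _)).const_smul _

lemma periodic_rightLog {u : ℝ → G} (hu : ContMDiff 𝓘(ℝ, ℝ) 𝓘(ℝ, E) ∞ u) {T : ℝ}
    (h : Function.Periodic u T) : Function.Periodic (fun θ => (rightLog u θ 1 : E)) T := by
  intro θ
  have hT : ContDiff ℝ ∞ fun s : ℝ => s + T := contDiff_id.add contDiff_const
  have h1 := rightLog_comp (E := E) hu hT θ 1
  have h2 : (fun s => u (s + T)) = u := funext h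
  rw [h2, fderiv_add_const] at h1
  simpa using h1.symm

/-- From x = g⁻¹Ψ, the current ∂x x⁻¹ is Ad(g)⁻¹ of a difference of periodic currents; x itself may
be only quasi-periodic. -/
lemma periodic_currentJ (υp υm : ℝ) (p : FactorisedField G R) {T : ℝ}
    (hg : Function.Periodic p.g T)
    (hp : Function.Periodic (fun θ => (rightLog p.psip θ 1 : E)) T)
    (hm : Function.Periodic (fun θ => (rightLog p.psim θ 1 : E)) T) :
    Function.Periodic (currentJ υp υm p) T := by
  have key : ∀ x psi : ℝ → G, ContMDiff 𝓘(ℝ, ℝ) 𝓘(ℝ, E) ∞ x → (∀ θ, psi θ = p.g θ * x θ) →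
      Function.Periodic (fun θ => (rightLog psi θ 1 : E)) T → ∀ θ,
      (rightLog x (θ + T) 1 : E) = rightLog x θ 1 := by
    intro x psi hx hpsi hper θ
    have e : psi = fun θ => p.g θ * x θ := funext hpsi
    have h1 : ∀ θ, (rightLog x θ 1 : E) =
        Ad (p.g θ)⁻¹ (rightLog psi θ 1 - rightLog p.g θ 1) := fun θ => by
      rw [e, rightLog_mul p.smooth_g hx, add_sub_cancel_left, Ad_inv_Ad]
    have h2 := hper θ
    have h3 := periodic_rightLog (E := E) p.smooth_g hg θ
    simp only at h2 h3
    rw [h1, h1 θ, h2, h3, hg θ]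
  intro θ
  rw [currentJ, currentJ, key _ _ p.smooth_x.smooth_p p.fact_p hp,
    key _ _ p.smooth_x.smooth_m p.fact_m hm]

omit [LieGroup 𝓘(ℝ, E) ∞ G] in
lemma rightLog_eq_smul_currentJ {υ : ℝ} (hυ : υ ≠ 0) (p : FactorisedField G R) (θ : ℝ) :
    rightLog p.xp θ 1 = υ • Rplus R (currentJ υ υ p θ) ∧
      rightLog p.xm θ 1 = υ • Rminus R (currentJ υ υ p θ) := by
  have h : currentJ υ υ p θ = υ⁻¹ • logGR p.xp p.xm θ 1 := by
    rw [currentJ, logGR]; module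
  rw [h, map_smul, map_smul, smul_inv_smul₀ hυ, smul_inv_smul₀ hυ]
  exact ⟨p.smooth_x.rightLog_p θ 1, p.smooth_x.rightLog_m θ 1⟩

end Currents

end RealBranch

end

/-! ### The theorem -/

theorem proposition5p1 {E : Type*} [NormedAddCommGroup E] [NormedSpace ℝ E] [FiniteDimensional ℝ E]
    {G : Type*} [TopologicalSpace G] [ChartedSpace E G] [Group G] [LieGroup 𝓘(ℝ, E) ∞ G]
    [T2Space G] [ConnectedSpace G]
    (B : LinearMap.BilinForm ℝ E) (hB : RealBranch.IsInvariantForm G B)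
    (R : E →ₗ[ℝ] E) (hR : RealBranch.IsSplitRMatrix G B R)
    (υp υm : ℝ) (hp : υp ≠ 0) (hm : υm ≠ 0) :
    -- `𝒥` is a smooth `𝔤`-valued field, periodic when `g` and the currents `∂Ψ^± (Ψ^±)⁻¹` are
    (∀ p : RealBranch.FactorisedField G R,
      ContDiff ℝ ∞ (RealBranch.currentJ υp υm p) ∧
      (Function.Periodic p.g (2 * Real.pi) →
        Function.Periodic (fun θ => (RealBranch.rightLog p.psip θ 1 : E)) (2 * Real.pi) →
        Function.Periodic (fun θ => (RealBranch.rightLog p.psim θ 1 : E)) (2 * Real.pi) →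
        Function.Periodic (RealBranch.currentJ υp υm p) (2 * Real.pi))) ∧
    -- the brackets, with central term `- ½ (υ_-⁻¹ - υ_+⁻¹) C₁₂ δ'`
    ((υp ≠ υm → R ∘ₗ R = LinearMap.id) →
      ∀ (p : RealBranch.FactorisedField G R) (a : ℝ),
        RealBranch.CotangentBrackets B υp υm ((1 / 2) * (υm⁻¹ - υp⁻¹)) a p) ∧
    -- for equal levels: the canonical brackets, and `∂x_± x_±⁻¹ = υ R^± 𝒥`
    (υp = υm → ∀ p : RealBranch.FactorisedField G R,
      (∀ θ : ℝ, RealBranch.rightLog p.xp θ 1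
          = υp • RealBranch.Rplus R (RealBranch.currentJ υp υm p θ) ∧
        RealBranch.rightLog p.xm θ 1
          = υp • RealBranch.Rminus R (RealBranch.currentJ υp υm p θ)) ∧
      ∀ a : ℝ, RealBranch.CotangentBrackets B υp υm 0 a p) ∧
    -- for different levels, `R² = id` is necessary
    (υp ≠ υm → R ∘ₗ R ≠ LinearMap.id →
      ∀ (p : RealBranch.FactorisedField G R) (a : ℝ),
        ∃ (f h : G → ℝ) (φ ψ : ℝ → ℝ) (v : ℝ),
          ContMDiff 𝓘(ℝ, E) 𝓘(ℝ, ℝ) ∞ f ∧ ContMDiff 𝓘(ℝ, E) 𝓘(ℝ, ℝ) ∞ h ∧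
          RealBranch.IsTest a φ ∧ RealBranch.IsTest a ψ ∧ v ≠ 0 ∧
          RealBranch.HasBracket B υp υm a (RealBranch.obsG f φ) (RealBranch.obsG h ψ) p v) := by
  have brackets : (υp ≠ υm → R ∘ₗ R = LinearMap.id) →
      ∀ (p : RealBranch.FactorisedField G R) (a : ℝ),
        RealBranch.CotangentBrackets B υp υm ((1 / 2) * (υm⁻¹ - υp⁻¹)) a p := fun hcase p a =>
    { gg := fun _ _ _ _ hf hh hφ hψ => RealBranch.hasBracket_gg_zero hB hR hcase hf hh hφ hψ p
      Jg := fun _ _ _ hf hφ hψ => RealBranch.hasBracket_Jg hB hR hp hm hcase hφ hf hψ p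
      JJ := fun _ _ hφ hψ => RealBranch.hasBracket_JJ hB hR hp hm hcase hφ hψ p }
  refine ⟨fun p => ⟨RealBranch.contDiff_currentJ υp υm p, RealBranch.periodic_currentJ υp υm p⟩,
    brackets, ?_, fun hυ hRR p a => RealBranch.exists_bracket_ne_zero hB hR hυ hRR p a⟩
  rintro rfl p
  refine ⟨RealBranch.rightLog_eq_smul_currentJ hp p, fun a => ?_⟩
  simpa using brackets (fun h => absurd rfl h) p a
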